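/- Let $I=(-1,1)$, $k\in\{1,2\}$, and let $b,f\in H^k(I)$ with $0<\underline b\le b\le\overline b$ on $I$ for constants $\underline b,\overline b$. For $0<\varepsilon\le 1$ put $\mathcal L_\varepsilon w=-\varepsilon^2w''+bw$ and $$B_\varepsilon(w,v)=\int_I\left(\varepsilon^2w'v'+b\,wv\right)dx,\qquad \|w\|_{1,\varepsilon,I}^2=B_\varepsilon(w,w)\qquad (v,w\in H^1(I)),$$ and let $u_\varepsilon\in H^1_0(I)$ be the (unique) weak solution of $\mathcal L_\varepsilon u_\varepsilon=f$, that is, $B_\varepsilon(u_\varepsilon,v)=\int_I fv\,dx$ for all $v\in H^1_0(I)$. Let $u_0=f/b$. Let $u^{BL}_{\varepsilon,-}$ and $u^{BL}_{\varepsilon,+}$ be the (unique) weak solutions in $H^1(I)$ of $\mathcal L_\varepsilon u^{BL}_{\varepsilon,\pm}=0$ in $I$ with the boundary values $$u^{BL}_{\varepsilon,-}(-1)=-u_0(-1),\quad u^{BL}_{\varepsilon,-}(1)=0,\qquad u^{BL}_{\varepsilon,+}(-1)=0,\quad u^{BL}_{\varepsilon,+}(1)=-u_0(1).$$ Define $u^R_\varepsilon$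 by $$u_\varepsilon=u_0+u^{BL}_{\varepsilon,-}+u^{BL}_{\varepsilon,+}+u^R_\varepsilon .$$ Then $u_0,u^R_\varepsilon\in H^k(I)$, $u^{BL}_{\varepsilon,\pm}\in H^{k+1}(I)$, and there is a constant $C>0$ which depends only on $k$, $\underline b$ and upper bounds for $\|b\|_{H^k(I)}$ and $\|f\|_{H^k(I)}$, and in particular not on $\varepsilon$, such that for all $0<\varepsilon\le1$ $$\|u_0\|_{H^k(I)}\le C,\qquad \|u^R_\varepsilon\|_{1,\varepsilon,I}\le C\varepsilon^k,\qquad \varepsilon^2\,\|(u^{BL}_{\varepsilon,\pm})''\|_{L^2(I;w^\pm_\varepsilon)}\le C,$$ where $\|v\|^2_{L^2(I;w^\pm_\varepsilon)}=\int_I v^2\,(w^\pm_\varepsilon)^2\,dx$, $w^\pm_\varepsilon(x)=\exp\left(\frac{1\mp x}{\varepsilon\beta_*}\right)$ and $\beta_*=2/\sqrt{\underline b}$. -/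

import Mathlib

open MeasureTheory

open scoped ContDiff

namespace SingPert

noncomputable section

/-- The open interval `I = (-1, 1)`. -/
abbrev I : Set ℝ := Set.Ioo (-1) 1

/-- Lebesgue measure on `I`. Functions `ℝ → ℝ` stand for functions on `I`; all notions below
depend only on their class modulo equality almost everywhere on `I`. -/
abbrev volI : Measure ℝ := volume.restrict I

/-- `g` is a weak derivative of `u` on `I`: both are locally integrable on `I`, and
`∫_I u φ' = - ∫_I g φ` for every test function `φ ∈ C_c^∞(I)`. -/
def HasWeakDeriv (u g : ℝ → ℝ) : Prop :=
  LocallyIntegrableOn u I volume ∧ LocallyIntegrableOn g I volume ∧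
    ∀ φ : ℝ → ℝ, ContDiff ℝ ∞ φ → HasCompactSupport φ → tsupport φ ⊆ I →
      ∫ x in I, u x * deriv φ x = - ∫ x in I, g x * φ x

open Classical in
/-- The weak derivative of `u` on `I` (unique almost everywhere on `I`), and `0` if there is
none. -/
def weakDeriv (u : ℝ → ℝ) : ℝ → ℝ :=
  if h : ∃ g, HasWeakDeriv u g then h.choose else 0

/-- Membership in the Sobolev space `H^k(I) = W^{k,2}(I)`. -/
def MemH : ℕ → (ℝ → ℝ) → Prop
  | 0, u => MemLp u 2 volI
  | k + 1, u => MemLp u 2 volI ∧ ∃ g, HasWeakDeriv u g ∧ MemH k g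

/-- The norm of `H^k(I)`: `‖u‖² = ∑_{j ≤ k} ‖u^(j)‖²_{L²(I)}`. -/
def hNorm (k : ℕ) (u : ℝ → ℝ) : ℝ :=
  Real.sqrt (∑ j ∈ Finset.range (k + 1), ∫ x in I, (weakDeriv^[j] u x) ^ 2)

/-- The continuous representative of `u` on `[-1, 1]` exists and takes the value `c` at `x`.
It is unique, so for `x = ± 1` this says that `u` has the trace `c` at `x`. -/
def HasTrace (u : ℝ → ℝ) (x c : ℝ) : Prop :=
  ∃ v : ℝ → ℝ, ContinuousOn v (Set.Icc (-1) 1) ∧ u =ᵐ[volI] v ∧ v x = c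

/-- Membership in `H^1_0(I)`: functions of `H^1(I)` with vanishing traces. -/
def MemH10 (u : ℝ → ℝ) : Prop :=
  MemH 1 u ∧ HasTrace u (-1) 0 ∧ HasTrace u 1 0

/-- The bilinear form `B_ε(w, v) = ∫_I (ε² w' v' + b w v)`. -/
def bilin (ε : ℝ) (b w v : ℝ → ℝ) : ℝ :=
  ∫ x in I, (ε ^ 2 * (weakDeriv w x * weakDeriv v x) + b x * w x * v x)

/-- The energy norm `‖w‖_{1,ε,I}`, with `‖w‖² = ∫_I (ε² (w')² + b w²)`. -/
def energyNorm (ε : ℝ) (b w : ℝ → ℝ) : ℝ :=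
  Real.sqrt (∫ x in I, (ε ^ 2 * weakDeriv w x ^ 2 + b x * w x ^ 2))

/-- `u ∈ H^1(I)` is a weak solution of `-ε² u'' + b u = g` in `I`, with the boundary values
`u(-1) = l` and `u(1) = r`. -/
def IsWeakSolution (ε : ℝ) (b g : ℝ → ℝ) (l r : ℝ) (u : ℝ → ℝ) : Prop :=
  MemH 1 u ∧ HasTrace u (-1) l ∧ HasTrace u 1 r ∧
    ∀ v, MemH10 v → bilin ε b u v = ∫ x in I, g x * v x

/-- `u` is the weak solution of `-ε² u'' + b u = g`, `u(-1) = l`, `u(1) = r`: it is one, and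
every other one equals it almost everywhere on `I`. -/
def IsTheWeakSolution (ε : ℝ) (b g : ℝ → ℝ) (l r : ℝ) (u : ℝ → ℝ) : Prop :=
  IsWeakSolution ε b g l r u ∧ ∀ v, IsWeakSolution ε b g l r v → v =ᵐ[volI] u

/-- `β_* = 2 / √b_`, for the lower bound `b_` of the reaction coefficient. -/
def betaStar (blo : ℝ) : ℝ := 2 / Real.sqrt blo

/-- The weight `w_ε^-(x) = exp((1 + x) / (ε β_*))`. -/
def weightMinus (blo ε x : ℝ) : ℝ := Real.exp ((1 + x) / (ε * betaStar blo))

/-- The weight `w_ε^+(x) = exp((1 - x) / (ε β_*))`. -/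
def weightPlus (blo ε x : ℝ) : ℝ := Real.exp ((1 - x) / (ε * betaStar blo))

/-- The weighted norm `‖v‖_{L²(I; w)}`, with `‖v‖² = ∫_I v² w²`. -/
def weightedNorm (w v : ℝ → ℝ) : ℝ :=
  Real.sqrt (∫ x in I, v x ^ 2 * w x ^ 2)

end

end SingPert

namespace SingPert

open Set Filter

/-! ### Integrals over `I` -/

/-! Since `b u₀ = f`, the reduced solution leaves only the residual `ε² u₀''`, and the two layers
repair its boundary values. The remainder therefore vanishes at both endpoints and satisfies
`B_ε(u^R, v) = -ε² ∫ u₀' v'` for `v` in `H^1_0(I)`. Take `v = u^R`. For `k = 1`, Cauchy–Schwarz and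
the control of `ε ‖(u^R)'‖` by the energy norm give the rate `ε` (`sqrt_energyForm_le`). For `k =
2`, an integration by parts leaves `ε² ∫ u₀'' u^R`, and the energy norm controls `‖u^R‖` without any
power of `ε`, whence `ε²` (`sqrt_energyForm_le_sq`).

For the layers, an exponential with rate `√b_ / ε` is a supersolution, so the maximum principle
gives pointwise decay. The equation `ε² u'' = b u` passes this decay on to `u''`, and the weight
grows at only half that rate (`boundaryLayer_bound`).

All computations use absolutely continuous representatives (`H1Rep`, supplied by
`HasWeakDeriv.exists_rep`); `H1Bound` carries the constants, and `exists_quotient_bound` controls `f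
/ b`. As `b` and `f` have continuous representatives, the boundary value problems have `C²`
solutions, found by a fixed point and shooting; coercivity identifies them with the weak solutions.
-/

lemma integral_volI (h : ℝ → ℝ) : ∫ x in I, h x = ∫ x in (-1 : ℝ)..1, h x := by
  rw [intervalIntegral.integral_of_le (by norm_num), integral_Ioc_eq_integral_Ioo]

lemma ae_volI_of_forall {p : ℝ → Prop} (h : ∀ x ∈ Icc (-1 : ℝ) 1, p x) : ∀ᵐ x ∂volI, p x := by
  filter_upwards [ae_restrict_mem measurableSet_Ioo] with x hx
  exact h x (Ioo_subset_Icc_self hx)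

lemma volI_eq_restrict_Icc : volI = volume.restrict (Icc (-1 : ℝ) 1) :=
  Measure.restrict_congr_set Ioo_ae_eq_Icc

lemma volI_eq_restrict_uIoc : volI = volume.restrict (uIoc (-1 : ℝ) 1) := by
  rw [uIoc_of_le (by norm_num)]
  exact Measure.restrict_congr_set Ioo_ae_eq_Ioc

lemma intervalIntegrable_iff_volI {g : ℝ → ℝ} :
    IntervalIntegrable g volume (-1) 1 ↔ Integrable g volI := by
  rw [intervalIntegrable_iff, volI_eq_restrict_uIoc, IntegrableOn]

lemma memLp_volI_of_continuousOn {v : ℝ → ℝ} (hv : ContinuousOn v (Icc (-1) 1)) {p : ENNReal} :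
    MemLp v p volI := by
  obtain ⟨M, hM⟩ := isCompact_Icc.exists_bound_of_continuousOn hv
  refine MemLp.of_bound ?_ M (ae_volI_of_forall hM)
  rw [volI_eq_restrict_Icc]
  exact hv.aestronglyMeasurable measurableSet_Icc

/-! ### Absolutely continuous representatives -/

/-- `v` is absolutely continuous on `[-1, 1]`, and its derivative is almost everywhere equal to
`g`, which is square integrable: `v` is the continuous representative of an element of `H^1(I)`
with weak derivative `g`. -/
structure H1Rep (v g : ℝ → ℝ) : Prop where
  ac : AbsolutelyContinuousOnInterval v (-1) 1
  deriv_ae : ∀ᵐ x ∂volI, HasDerivAt v (g x) x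
  memLp : MemLp g 2 volI

namespace H1Rep

variable {v g v' g' : ℝ → ℝ}

lemma continuousOn (h : H1Rep v g) : ContinuousOn v (Icc (-1) 1) := by
  have := h.ac.continuousOn
  rwa [uIcc_of_le (by norm_num)] at this

lemma memLp_left (h : H1Rep v g) {p : ENNReal} : MemLp v p volI :=
  memLp_volI_of_continuousOn h.continuousOn

lemma deriv_eq (h : H1Rep v g) : deriv v =ᵐ[volI] g := by
  filter_upwards [h.deriv_ae] with x hx using hx.deriv

lemma congr_right (h : H1Rep v g) (hg : g =ᵐ[volI] g') : H1Rep v g' := by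
  refine ⟨h.ac, ?_, h.memLp.ae_eq hg⟩
  filter_upwards [h.deriv_ae, hg] with x hx hx' using hx' ▸ hx

lemma add (h : H1Rep v g) (h' : H1Rep v' g') :
    H1Rep (fun x => v x + v' x) (fun x => g x + g' x) := by
  refine ⟨h.ac.fun_add h'.ac, ?_, h.memLp.add h'.memLp⟩
  filter_upwards [h.deriv_ae, h'.deriv_ae] with x hx hx' using hx.add hx'

lemma sub (h : H1Rep v g) (h' : H1Rep v' g') :
    H1Rep (fun x => v x - v' x) (fun x => g x - g' x) := by
  refine ⟨h.ac.fun_sub h'.ac, ?_, h.memLp.sub h'.memLp⟩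
  filter_upwards [h.deriv_ae, h'.deriv_ae] with x hx hx' using hx.sub hx'

lemma const_mul (h : H1Rep v g) (c : ℝ) : H1Rep (fun x => c * v x) (fun x => c * g x) := by
  refine ⟨h.ac.const_mul c, ?_, h.memLp.const_mul c⟩
  filter_upwards [h.deriv_ae] with x hx using hx.const_mul c

lemma mul_continuousOn_memLp {p : ENNReal} {c : ℝ → ℝ} (hg : MemLp g p volI)
    (hc : ContinuousOn c (Icc (-1) 1)) : MemLp (fun x => g x * c x) p volI :=
  (memLp_volI_of_continuousOn hc).mul (p := p) (q := ⊤) hg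

lemma mul (h : H1Rep v g) (h' : H1Rep v' g') :
    H1Rep (fun x => v x * v' x) (fun x => g x * v' x + g' x * v x) := by
  refine ⟨h.ac.fun_mul h'.ac, ?_, (mul_continuousOn_memLp h.memLp h'.continuousOn).add
    (mul_continuousOn_memLp h'.memLp h.continuousOn)⟩
  filter_upwards [h.deriv_ae, h'.deriv_ae] with x hx hx'
  exact (hx.mul hx').congr_deriv (by ring)

lemma integral_mul_add (h : H1Rep v g) (h' : H1Rep v' g') :
    ∫ x in I, (g x * v' x + v x * g' x) = v 1 * v' 1 - v (-1) * v' (-1) := by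
  rw [← h.ac.integral_deriv_mul_eq_sub h'.ac, ← integral_volI]
  refine integral_congr_ae ?_
  filter_upwards [h.deriv_eq, h'.deriv_eq] with x hx hx'
  rw [hx, hx']

lemma integral_mul_right (h : H1Rep v g) (h' : H1Rep v' g') :
    ∫ x in I, v x * g' x = v 1 * v' 1 - v (-1) * v' (-1) - ∫ x in I, g x * v' x := by
  rw [← h.integral_mul_add h', integral_add]
  · ring
  · exact (mul_continuousOn_memLp h.memLp h'.continuousOn).integrable one_le_two
  · simpa only [mul_comm] using
      (mul_continuousOn_memLp h'.memLp h.continuousOn).integrable one_le_two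

lemma sub_eq_integral (h : H1Rep v g) {x y : ℝ} (hx : x ∈ Icc (-1 : ℝ) 1)
    (hy : y ∈ Icc (-1 : ℝ) 1) : v y - v x = ∫ t in x..y, g t := by
  have hs : uIcc x y ⊆ uIcc (-1 : ℝ) 1 := by
    rw [uIcc_of_le (by norm_num : (-1 : ℝ) ≤ 1)]
    exact uIcc_subset_Icc hx hy
  rw [← (h.ac.mono hs).integral_deriv_eq_sub]
  refine intervalIntegral.integral_congr_ae ?_
  have := h.deriv_eq
  rw [volI_eq_restrict_Icc, EventuallyEq, ae_restrict_iff' measurableSet_Icc] at this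
  filter_upwards [this] with t ht htx
  exact ht (uIcc_subset_Icc hx hy (uIoc_subset_uIcc htx))

/-- The reciprocal of a representative that is bounded below. -/
lemma inv {m : ℝ} (h : H1Rep v g) (hm : 0 < m) (hv : ∀ x ∈ Icc (-1 : ℝ) 1, m ≤ v x) :
    H1Rep (fun x => (v x)⁻¹) (fun x => -g x / v x ^ 2) := by
  have hu : uIcc (-1 : ℝ) 1 = Icc (-1) 1 := uIcc_of_le (by norm_num)
  refine ⟨?_, ?_, ?_⟩
  · have hL : ∀ x ∈ Icc (-1 : ℝ) 1, ∀ y ∈ Icc (-1 : ℝ) 1,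
        dist (v x)⁻¹ (v y)⁻¹ ≤ (m ^ 2)⁻¹ * dist (v x) (v y) := by
      intro x hx y hy
      have h1 := hv x hx
      have h2 := hv y hy
      have h3 : 0 < v x := by linarith
      have h4 : 0 < v y := by linarith
      rw [dist_inv_inv₀ h3.ne' h4.ne', div_eq_inv_mul, Real.norm_eq_abs, Real.norm_eq_abs,
        abs_of_pos h3, abs_of_pos h4]
      gcongr
      nlinarith
    -- Absolute continuity is the convergence to zero of sums of increments along a filter on
    -- families of intervals. Inversion is Lipschitz on `[m, ∞)` with constant `1 / m²`, so the sums
    -- for the reciprocal are squeezed.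
    refine squeeze_zero' (Eventually.of_forall fun t => Finset.sum_nonneg fun i _ => dist_nonneg)
      ?_ (by simpa using Filter.Tendsto.const_mul (m ^ 2)⁻¹ h.ac)
    refine eventually_inf_principal.2 (Eventually.of_forall fun E hE => ?_)
    rw [Finset.mul_sum]
    refine Finset.sum_le_sum fun i hi => ?_
    have := hE.1 i hi
    rw [hu] at this
    exact hL _ this.1 _ this.2
  · filter_upwards [h.deriv_ae, ae_volI_of_forall hv] with x hx hx'
    exact hx.inv (by linarith)
  · have hc : ContinuousOn (fun x => -(v x ^ 2)⁻¹) (Icc (-1) 1) :=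
      ((h.continuousOn.pow 2).inv₀ fun x hx => (pow_pos (hm.trans_le (hv x hx)) 2).ne').neg
    refine (mul_continuousOn_memLp h.memLp hc).ae_eq (Eventually.of_forall fun x => ?_)
    simp only [div_eq_mul_inv]; ring

/-- The primitive of a square integrable function. -/
lemma primitive (hg : MemLp g 2 volI) (c : ℝ) : H1Rep (fun x => c + ∫ t in (-1 : ℝ)..x, g t) g := by
  have hi : IntervalIntegrable g volume (-1) 1 :=
    intervalIntegrable_iff_volI.2 (hg.integrable one_le_two)
  refine ⟨?_, ?_, hg⟩
  · refine AbsolutelyContinuousOnInterval.fun_add ?_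
      (hi.absolutelyContinuousOnInterval_intervalIntegral (by simp))
    exact (contDiff_const.contDiffOn).absolutelyContinuousOnInterval
  · have h1 := ae_restrict_of_ae (s := I) hi.ae_hasDerivAt_integral
    filter_upwards [h1, ae_restrict_mem measurableSet_Ioo] with x hx hxI
    have hx' : x ∈ uIcc (-1 : ℝ) 1 := by
      rw [uIcc_of_le (by norm_num)]; exact Ioo_subset_Icc_self hxI
    exact (hx hx' (-1) (by simp)).const_add c

lemma of_contDiff (hv : ContDiff ℝ 1 v) : H1Rep v (deriv v) :=
  ⟨hv.contDiffOn.absolutelyContinuousOnInterval,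
    Eventually.of_forall fun x => (hv.differentiable one_ne_zero x).hasDerivAt,
    memLp_volI_of_continuousOn (hv.continuous_deriv le_rfl).continuousOn⟩

lemma of_hasDerivAt (hv : ∀ x, HasDerivAt v (g x) x) (hg : Continuous g) : H1Rep v g := by
  have hd : deriv v = g := funext fun x => (hv x).deriv
  rw [← hd]
  refine of_contDiff (contDiff_one_iff_deriv.2 ⟨fun x => (hv x).differentiableAt, ?_⟩)
  rwa [hd]

lemma congr_left (h : H1Rep v g) (hv : EqOn v v' (Icc (-1) 1)) : H1Rep v' g := by
  refine ⟨?_, ?_, h.memLp⟩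
  · have h0 : AbsolutelyContinuousOnInterval v (-1) 1 := h.ac
    unfold AbsolutelyContinuousOnInterval at h0 ⊢
    refine h0.congr' (eventually_inf_principal.2 (Eventually.of_forall fun E hE => ?_))
    refine Finset.sum_congr rfl fun i hi => ?_
    have := hE.1 i hi
    rw [uIcc_of_le (by norm_num : (-1 : ℝ) ≤ 1)] at this
    rw [hv this.1, hv this.2]
  · filter_upwards [h.deriv_ae, ae_restrict_mem measurableSet_Ioo] with x hx hxI
    refine hx.congr_of_eventuallyEq ?_
    filter_upwards [isOpen_Ioo.mem_nhds hxI] with y hy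
    exact (hv (Ioo_subset_Icc_self hy)).symm

lemma hasWeakDeriv (h : H1Rep v g) : HasWeakDeriv v g := by
  refine ⟨?_, ?_, fun φ hφ _ hs => ?_⟩
  · exact (h.continuousOn.mono Ioo_subset_Icc_self).locallyIntegrableOn measurableSet_Ioo
  · exact IntegrableOn.locallyIntegrableOn (h.memLp.integrable one_le_two)
  · have hz : ∀ x : ℝ, x ∉ I → φ x = 0 := fun x hx =>
      image_eq_zero_of_notMem_tsupport fun h => hx (hs h)
    have hφ' := of_contDiff (hφ.of_le (by exact_mod_cast le_top) : ContDiff ℝ 1 φ)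
    rw [h.integral_mul_right hφ', hz 1 (by simp [I]), hz (-1) (by simp [I])]
    ring

end H1Rep

/-! ### Weak derivatives -/

lemma HasWeakDeriv.congr {u u' g g' : ℝ → ℝ} (h : HasWeakDeriv u g) (hu : u =ᵐ[volI] u')
    (hg : g =ᵐ[volI] g') : HasWeakDeriv u' g' := by
  obtain ⟨h1, h2, h3⟩ := h
  refine ⟨h1.congr hu, h2.congr hg, fun φ a b c => ?_⟩
  rw [integral_congr_ae (g := fun x => u x * deriv φ x), h3 φ a b c,
    integral_congr_ae (f := fun x => g x * φ x) (g := fun x => g' x * φ x)]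
  · filter_upwards [hg] with x hx; rw [hx]
  · filter_upwards [hu] with x hx; rw [hx]

lemma integrable_mul_test {g φ : ℝ → ℝ} (hg : LocallyIntegrableOn g I volume) (hφ : Continuous φ)
    (hc : HasCompactSupport φ) (hs : tsupport φ ⊆ I) : Integrable (fun x => g x * φ x) volI := by
  have h1 : IntegrableOn g (tsupport φ) := hg.integrableOn_compact_subset hs hc
  have h2 : IntegrableOn (fun x => g x * φ x) (tsupport φ) :=
    h1.mul_continuousOn hφ.continuousOn hc
  refine IntegrableOn.of_forall_sdiff_eq_zero h2 measurableSet_Ioo fun x hx => ?_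
  rw [image_eq_zero_of_notMem_tsupport hx.2, mul_zero]

lemma HasWeakDeriv.sub {u u' g g' : ℝ → ℝ} (h : HasWeakDeriv u g) (h' : HasWeakDeriv u' g') :
    HasWeakDeriv (fun x => u x - u' x) (fun x => g x - g' x) := by
  refine ⟨h.1.sub h'.1, h.2.1.sub h'.2.1, fun φ a b c => ?_⟩
  have hd : Continuous (deriv φ) := a.continuous_deriv (by exact_mod_cast le_top)
  have hs : tsupport (deriv φ) ⊆ I := (closure_mono (support_deriv_subset)).trans
    (by rw [tsupport, closure_closure]; exact c)
  simp only [sub_mul]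
  rw [integral_sub (integrable_mul_test h.1 hd b.deriv hs) (integrable_mul_test h'.1 hd b.deriv hs),
    integral_sub (integrable_mul_test h.2.1 a.continuous b c)
      (integrable_mul_test h'.2.1 a.continuous b c), h.2.2 φ a b c, h'.2.2 φ a b c]
  ring

lemma HasWeakDeriv.ae_unique {u g g' : ℝ → ℝ} (h : HasWeakDeriv u g) (h' : HasWeakDeriv u g') :
    g =ᵐ[volI] g' := by
  have h0 := h.sub h'
  have := isOpen_Ioo.ae_eq_zero_of_integral_contDiff_smul_eq_zero (U := I) h0.2.1
    fun φ a b c => by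
      have h1 := h0.2.2 φ a b c
      simp only [sub_self, zero_mul, integral_zero] at h1
      have h2 : ∫ x in I, φ x * (g x - g' x) = 0 := by
        simp only [mul_comm (φ _)]; linarith
      rw [← setIntegral_eq_integral_of_forall_compl_eq_zero (s := I)]
      · simpa using h2
      · intro x hx
        rw [image_eq_zero_of_notMem_tsupport fun h => hx (c h), zero_smul]
  rw [EventuallyEq, ae_restrict_iff' measurableSet_Ioo]
  filter_upwards [this] with x hx hxI
  linarith [hx hxI]

lemma HasWeakDeriv.weakDeriv_eq {u g : ℝ → ℝ} (h : HasWeakDeriv u g) : weakDeriv u =ᵐ[volI] g := by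
  have he : ∃ g, HasWeakDeriv u g := ⟨g, h⟩
  rw [weakDeriv, dif_pos he]
  exact he.choose_spec.ae_unique h

/-- A function with vanishing weak derivative is constant. -/
lemma HasWeakDeriv.ae_const {w : ℝ → ℝ} (h : HasWeakDeriv w 0) : ∃ c, w =ᵐ[volI] fun _ => c := by
  -- The du Bois-Reymond argument: with a fixed test function `θ` of integral one, `ψ - (∫ ψ) θ` has
  -- mean zero for every test function `ψ`, so it is the derivative of a test function. Testing with
  -- that primitive gives `∫ w ψ = c ∫ ψ`.
  let B : ContDiffBump (0 : ℝ) := ⟨1 / 4, 1 / 2, by norm_num, by norm_num⟩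
  set θ : ℝ → ℝ := B.normed volume with hθ
  have hθc : ContDiff ℝ ∞ θ := B.contDiff_normed
  have hθs : tsupport θ = Icc (-(1 / 2)) (1 / 2) := by
    rw [hθ, B.tsupport_normed_eq, Real.closedBall_eq_Icc]
    change Icc (0 - (1 / 2)) (0 + 1 / 2) = _
    simp
  have hθI : tsupport θ ⊆ I := by
    rw [hθs]; exact Icc_subset_Ioo (by norm_num) (by norm_num)
  have hθk : HasCompactSupport θ := B.hasCompactSupport_normed
  have hθ1 : ∫ x, θ x = 1 := B.integral_normed
  refine ⟨∫ x in I, w x * θ x, ?_⟩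
  set c := ∫ x in I, w x * θ x with hc
  have key := isOpen_Ioo.ae_eq_zero_of_integral_contDiff_smul_eq_zero (U := I)
    (f := fun x => w x - c) (μ := volume)
    (h.1.sub (continuousOn_const.locallyIntegrableOn measurableSet_Ioo)) ?_
  · rw [EventuallyEq, ae_restrict_iff' measurableSet_Ioo]
    filter_upwards [key] with x hx hxI
    linarith [hx hxI]
  intro ψ hψ hψk hψI
  set m := ∫ x, ψ x with hm
  set η : ℝ → ℝ := fun x => ψ x - m * θ x with hη
  have hηc : ContDiff ℝ ∞ η := hψ.sub (contDiff_const.mul hθc)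
  set K := tsupport ψ ∪ tsupport θ with hK
  have hKc : IsCompact K := hψk.isCompact.union hθk.isCompact
  have hKn : K.Nonempty := ⟨0, Or.inr (by rw [hθs]; constructor <;> norm_num)⟩
  have hKI : K ⊆ I := union_subset hψI hθI
  set p := sInf K with hp
  set q := sSup K with hq
  have hpI : p ∈ I := hKI (hKc.sInf_mem hKn)
  have hqI : q ∈ I := hKI (hKc.sSup_mem hKn)
  have hη0 : ∀ x, x ∉ Icc p q → η x = 0 := by
    intro x hx
    have hxK : x ∉ K := fun h => hx (subset_Icc_csInf_csSup hKc.bddBelow hKc.bddAbove h)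
    have h1 : ψ x = 0 := image_eq_zero_of_notMem_tsupport fun h => hxK (Or.inl h)
    have h2 : θ x = 0 := image_eq_zero_of_notMem_tsupport fun h => hxK (Or.inr h)
    simp [hη, h1, h2]
  have hηI : ∫ x in (-1 : ℝ)..1, η x = 0 := by
    rw [← integral_volI, setIntegral_eq_integral_of_forall_compl_eq_zero, hη]
    · rw [integral_sub (hψ.continuous.integrable_of_hasCompactSupport hψk)
        ((hθc.continuous.integrable_of_hasCompactSupport hθk).const_mul m), integral_const_mul, hθ1]
      simp [hm]
    · intro x hx
      exact hη0 x fun h => hx ⟨hpI.1.trans_le h.1, h.2.trans_lt hqI.2⟩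
  set φ : ℝ → ℝ := fun x => ∫ t in (-1 : ℝ)..x, η t with hφ
  have hφd : ∀ x, HasDerivAt φ (η x) x := fun x =>
    intervalIntegral.integral_hasDerivAt_right (hηc.continuous.intervalIntegrable _ _)
      (hηc.continuous.stronglyMeasurableAtFilter _ _) hηc.continuous.continuousAt
  have hdφ : deriv φ = η := funext fun x => (hφd x).deriv
  have hφc : ContDiff ℝ ∞ φ :=
    contDiff_infty_iff_deriv.2 ⟨fun x => (hφd x).differentiableAt, hdφ ▸ hηc⟩
  -- To the left of `p` nothing has been integrated yet; to the right of `q` the whole integral of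
  -- `η`, which is zero, has been collected.
  have hφ0 : ∀ x, x ∉ Icc p q → φ x = 0 := by
    intro x hx
    rcases lt_or_ge x p with hxp | hxp
    · rw [hφ]
      refine (intervalIntegral.integral_congr fun t ht => hη0 t fun h => ?_).trans
        intervalIntegral.integral_zero
      have := ht.2
      rcases le_max_iff.1 this with h1 | h1
      · linarith [h.1, hpI.1]
      · linarith [h.1]
    · have hxq : q < x := by
        by_contra hh
        exact hx ⟨hxp, not_lt.1 hh⟩
      have : φ x = (∫ t in (-1 : ℝ)..1, η t) + ∫ t in (1 : ℝ)..x, η t :=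
        (intervalIntegral.integral_add_adjacent_intervals
          (hηc.continuous.intervalIntegrable _ _) (hηc.continuous.intervalIntegrable _ _)).symm
      rw [this, hηI, zero_add]
      refine (intervalIntegral.integral_congr fun t ht => hη0 t fun h => ?_).trans
        intervalIntegral.integral_zero
      have := ht.1
      rcases min_le_iff.1 this with h1 | h1
      · linarith [h.2, hqI.2]
      · linarith [h.2]
  have hφs : tsupport φ ⊆ Icc p q :=
    closure_minimal (fun x hx => by by_contra hh; exact hx (hφ0 x hh)) isClosed_Icc
  have h0 := h.2.2 φ hφc (HasCompactSupport.intro isCompact_Icc hφ0)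
    (hφs.trans (Icc_subset_Ioo hpI.1 hqI.2))
  simp only [hdφ, hη, mul_sub, Pi.zero_apply, zero_mul, integral_zero, neg_zero] at h0
  have iψ := integrable_mul_test h.1 hψ.continuous hψk hψI
  have iθ := integrable_mul_test h.1 hθc.continuous hθk hθI
  have e1 : ∀ x, w x * (m * θ x) = m * (w x * θ x) := fun x => by ring
  simp only [e1] at h0
  rw [integral_sub iψ (iθ.const_mul m), integral_const_mul, ← hc] at h0
  have e2 : ∫ x in I, ψ x = m :=
    setIntegral_eq_integral_of_forall_compl_eq_zero fun x hx =>
      image_eq_zero_of_notMem_tsupport fun h => hx (hψI h)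
  rw [← setIntegral_eq_integral_of_forall_compl_eq_zero (s := I)]
  · have e3 : ∀ x, ψ x • (w x - c) = w x * ψ x - c * ψ x := fun x => by
      simp only [smul_eq_mul]; ring
    simp only [e3]
    rw [integral_sub iψ (((hψ.continuous.integrable_of_hasCompactSupport hψk).integrableOn).const_mul
      c), integral_const_mul, e2]
    linarith
  · intro x hx
    rw [image_eq_zero_of_notMem_tsupport fun h => hx (hψI h), zero_smul]

/-- Subtracting the primitive of `g` leaves a function with zero weak derivative, hence a constant,
which becomes the initial value of the representative. -/
lemma HasWeakDeriv.exists_rep {u g : ℝ → ℝ} (h : HasWeakDeriv u g) (hg : MemLp g 2 volI) :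
    ∃ v, H1Rep v g ∧ u =ᵐ[volI] v := by
  have hp := H1Rep.primitive hg 0
  have h0 := (h.sub hp.hasWeakDeriv).congr (g' := 0) (EventuallyEq.refl _ _)
    (Eventually.of_forall fun x => by simp)
  obtain ⟨c, hc⟩ := h0.ae_const
  refine ⟨_, H1Rep.primitive hg c, ?_⟩
  filter_upwards [hc] with x hx
  linarith

lemma MemH.exists_rep {u : ℝ → ℝ} (h : MemH 1 u) : ∃ v g, H1Rep v g ∧ u =ᵐ[volI] v := by
  obtain ⟨_, g, hw, hg⟩ := h
  obtain ⟨v, hv, hu⟩ := hw.exists_rep hg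
  exact ⟨v, g, hv, hu⟩

/-! ### Square integrable functions -/

/-- Cauchy–Schwarz: the quadratic polynomial `∫ (t f + g)²` in `t` is nonnegative, so its
discriminant is not positive. -/
lemma sq_integral_mul_le {f g : ℝ → ℝ} (hf : MemLp f 2 volI) (hg : MemLp g 2 volI) :
    (∫ x in I, f x * g x) ^ 2 ≤ (∫ x in I, f x ^ 2) * ∫ x in I, g x ^ 2 := by
  have h1 : ∀ t : ℝ, 0 ≤ (∫ x in I, f x ^ 2) * (t * t) + (2 * ∫ x in I, f x * g x) * t
      + ∫ x in I, g x ^ 2 := by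
    intro t
    have h2 : 0 ≤ ∫ x in I, (t * f x + g x) ^ 2 := integral_nonneg fun x => sq_nonneg _
    have h3 : ∀ x, (t * f x + g x) ^ 2 = (t * t) * f x ^ 2 + (2 * t) * (f x * g x) + g x ^ 2 :=
      fun x => by ring
    simp only [h3] at h2
    have i1 : Integrable (fun x => t * t * f x ^ 2) volI := hf.integrable_sq.const_mul _
    have i2 : Integrable (fun x => 2 * t * (f x * g x)) volI := (hf.integrable_mul hg).const_mul _
    rw [integral_add (f := fun x => t * t * f x ^ 2 + 2 * t * (f x * g x)) (i1.add i2)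
      hg.integrable_sq, integral_add i1 i2, integral_const_mul, integral_const_mul] at h2
    linarith
  have := discrim_le_zero h1
  rw [discrim] at this
  linarith

lemma abs_integral_mul_le {f g : ℝ → ℝ} (hf : MemLp f 2 volI) (hg : MemLp g 2 volI) {A B : ℝ}
    (hA : 0 ≤ A) (hB : 0 ≤ B) (hfA : ∫ x in I, f x ^ 2 ≤ A ^ 2) (hgB : ∫ x in I, g x ^ 2 ≤ B ^ 2) :
    |∫ x in I, f x * g x| ≤ A * B := by
  refine abs_le_of_sq_le_sq ?_ (by positivity)
  refine (sq_integral_mul_le hf hg).trans ?_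
  rw [mul_pow]
  exact mul_le_mul hfA hgB (integral_nonneg fun x => sq_nonneg _) (by positivity)

lemma integral_volI_const (c : ℝ) : ∫ _ in I, c = 2 * c := by
  rw [integral_volI, intervalIntegral.integral_const]
  norm_num

lemma integral_sq_le_of_bound {v : ℝ → ℝ} {M : ℝ} (hv : MemLp v 2 volI)
    (hM : ∀ x ∈ Icc (-1 : ℝ) 1, |v x| ≤ M) : ∫ x in I, v x ^ 2 ≤ 2 * M ^ 2 := by
  rw [← integral_volI_const]
  refine integral_mono_ae hv.integrable_sq (integrable_const _) (ae_volI_of_forall fun x hx => ?_)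
  exact sq_le_sq' (abs_le.1 (hM x hx)).1 (abs_le.1 (hM x hx)).2

/-! ### Quantitative bounds for representatives -/

/-- The embedding of `H^1(I)` into the bounded functions. -/
lemma H1Rep.sq_le {v g : ℝ → ℝ} (h : H1Rep v g) {x : ℝ} (hx : x ∈ Icc (-1 : ℝ) 1) :
    v x ^ 2 ≤ (∫ y in I, v y ^ 2) + 4 * ∫ y in I, g y ^ 2 := by
  set G := ∫ y in I, g y ^ 2 with hG
  have hga : MemLp (fun x => |g x|) 2 volI := h.memLp.abs
  have h1 : (∫ y in I, |g y|) ^ 2 ≤ 2 * G := by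
    have := sq_integral_mul_le (memLp_const (1 : ℝ)) hga
    simp only [one_mul, one_pow, sq_abs, integral_volI_const] at this
    linarith
  -- The value at `x` is compared with the value at every `y`; averaging over `y` in an interval of
  -- length 2 then gives the bound.
  have h2 : ∀ y ∈ Icc (-1 : ℝ) 1, v x ^ 2 ≤ 2 * v y ^ 2 + 4 * G := by
    intro y hy
    have h3 : |v x - v y| ≤ ∫ y in I, |g y| := by
      rw [h.sub_eq_integral hy hx]
      have hi : IntegrableOn (fun t => |g t|) (Ioc (-1) 1) := by
        rw [IntegrableOn, ← uIoc_of_le (by norm_num : (-1 : ℝ) ≤ 1), ← volI_eq_restrict_uIoc]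
        exact hga.integrable one_le_two
      refine (intervalIntegral.norm_integral_le_integral_norm_uIoc (f := g)).trans ?_
      rw [← integral_Ioc_eq_integral_Ioo]
      exact setIntegral_mono_set hi (Eventually.of_forall fun t => abs_nonneg _)
        (Ioc_subset_Ioc (le_min hy.1 hx.1) (max_le hy.2 hx.2)).eventuallyLE
    have h4 : (v x - v y) ^ 2 ≤ 2 * G :=
      (sq_le_sq' (abs_le.1 h3).1 (abs_le.1 h3).2).trans h1
    nlinarith [sq_nonneg (v x - 2 * v y)]
  have h5 : ∫ _ in I, v x ^ 2 ≤ ∫ y in I, (2 * v y ^ 2 + 4 * G) :=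
    integral_mono_ae (integrable_const _)
      ((h.memLp_left.integrable_sq.const_mul 2).add (integrable_const _)) (ae_volI_of_forall h2)
  rw [integral_add (h.memLp_left.integrable_sq.const_mul 2) (integrable_const _),
    integral_const_mul, integral_volI_const, integral_volI_const] at h5
  linarith

/-- A representative with a bound for its maximum and for the `L²` norm of its derivative. -/
structure H1Bound (M : ℝ) (v g : ℝ → ℝ) : Prop where
  rep : H1Rep v g
  abs_le : ∀ x ∈ Icc (-1 : ℝ) 1, |v x| ≤ M
  integral_sq_le : ∫ x in I, g x ^ 2 ≤ M ^ 2

namespace H1Bound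

variable {M N : ℝ} {v g v' g' : ℝ → ℝ}

lemma nonneg (h : H1Bound M v g) : 0 ≤ M := (abs_nonneg _).trans (h.abs_le 0 (by simp))

lemma mono (h : H1Bound M v g) (hMN : M ≤ N) : H1Bound N v g :=
  ⟨h.rep, fun x hx => (h.abs_le x hx).trans hMN,
    h.integral_sq_le.trans (pow_le_pow_left₀ h.nonneg hMN 2)⟩

/-- The factor 2 is the square root of the constant 4 in the embedding `H1Rep.sq_le`. -/
lemma of_norm_le (h : H1Rep v g) (hM : 0 ≤ M)
    (hs : (∫ x in I, v x ^ 2) + ∫ x in I, g x ^ 2 ≤ M ^ 2) : H1Bound (2 * M) v g := by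
  have h1 : 0 ≤ ∫ x in I, v x ^ 2 := integral_nonneg fun x => sq_nonneg _
  have h2 : 0 ≤ ∫ x in I, g x ^ 2 := integral_nonneg fun x => sq_nonneg _
  refine ⟨h, fun x hx => ?_, by nlinarith⟩
  have := h.sq_le hx
  exact abs_le_of_sq_le_sq (by nlinarith) (by positivity)

lemma integral_sq_left_le (h : H1Bound M v g) : ∫ x in I, v x ^ 2 ≤ 2 * M ^ 2 :=
  integral_sq_le_of_bound h.rep.memLp_left h.abs_le

lemma add (h : H1Bound M v g) (h' : H1Bound N v' g') :
    H1Bound (2 * (M + N)) (fun x => v x + v' x) (fun x => g x + g' x) := by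
  have hM := h.nonneg
  have hN := h'.nonneg
  refine ⟨h.rep.add h'.rep, fun x hx => ?_, ?_⟩
  · have := abs_add_le (v x) (v' x)
    have := h.abs_le x hx
    have := h'.abs_le x hx
    linarith
  · have h1 : ∫ x in I, (g x + g' x) ^ 2 ≤ ∫ x in I, (2 * g x ^ 2 + 2 * g' x ^ 2) :=
      integral_mono (h.rep.memLp.add h'.rep.memLp).integrable_sq
        ((h.rep.memLp.integrable_sq.const_mul 2).add (h'.rep.memLp.integrable_sq.const_mul 2))
        fun x => by simp only; nlinarith [sq_nonneg (g x - g' x)]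
    rw [integral_add (h.rep.memLp.integrable_sq.const_mul 2)
      (h'.rep.memLp.integrable_sq.const_mul 2), integral_const_mul, integral_const_mul] at h1
    nlinarith [h.integral_sq_le, h'.integral_sq_le, mul_nonneg hM hN]

lemma mul (h : H1Bound M v g) (h' : H1Bound N v' g') :
    H1Bound (2 * (M * N)) (fun x => v x * v' x) (fun x => g x * v' x + g' x * v x) := by
  have hM := h.nonneg
  have hN := h'.nonneg
  refine ⟨h.rep.mul h'.rep, fun x hx => ?_, ?_⟩
  · rw [abs_mul]
    have := mul_le_mul (h.abs_le x hx) (h'.abs_le x hx) (abs_nonneg _) hM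
    have := mul_nonneg hM hN
    linarith
  · have h1 : ∫ x in I, (g x * v' x + g' x * v x) ^ 2 ≤
        ∫ x in I, (2 * N ^ 2 * g x ^ 2 + 2 * M ^ 2 * g' x ^ 2) := by
      refine integral_mono_ae (h.rep.mul h'.rep).memLp.integrable_sq
        ((h.rep.memLp.integrable_sq.const_mul _).add (h'.rep.memLp.integrable_sq.const_mul _))
        (ae_volI_of_forall fun x hx => ?_)
      have e1 : v x ^ 2 ≤ M ^ 2 := sq_le_sq' (_root_.abs_le.1 (h.abs_le x hx)).1
        (_root_.abs_le.1 (h.abs_le x hx)).2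
      have e2 : v' x ^ 2 ≤ N ^ 2 := sq_le_sq' (_root_.abs_le.1 (h'.abs_le x hx)).1
        (_root_.abs_le.1 (h'.abs_le x hx)).2
      simp only
      nlinarith [sq_nonneg (g x * v' x - g' x * v x), mul_le_mul_of_nonneg_left e1 (sq_nonneg (g' x)),
        mul_le_mul_of_nonneg_left e2 (sq_nonneg (g x))]
    rw [integral_add (h.rep.memLp.integrable_sq.const_mul _)
      (h'.rep.memLp.integrable_sq.const_mul _), integral_const_mul, integral_const_mul] at h1
    have e3 := mul_le_mul_of_nonneg_left h.integral_sq_le (by positivity : 0 ≤ 2 * N ^ 2)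
    have e4 := mul_le_mul_of_nonneg_left h'.integral_sq_le (by positivity : 0 ≤ 2 * M ^ 2)
    nlinarith

lemma neg (h : H1Bound M v g) : H1Bound M (fun x => -v x) (fun x => -g x) := by
  refine ⟨?_, fun x hx => by rw [abs_neg]; exact h.abs_le x hx, by
    simpa only [neg_sq] using h.integral_sq_le⟩
  simpa only [neg_one_mul] using h.rep.const_mul (-1)

lemma inv {m : ℝ} (h : H1Bound M v g) (hm : 0 < m) (hv : ∀ x ∈ Icc (-1 : ℝ) 1, m ≤ v x) :
    H1Bound (m⁻¹ + M / m ^ 2) (fun x => (v x)⁻¹) (fun x => -g x / v x ^ 2) := by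
  have hM := h.nonneg
  have hr := h.rep.inv hm hv
  refine ⟨hr, fun x hx => ?_, ?_⟩
  · have h1 := hv x hx
    rw [abs_inv, abs_of_pos (hm.trans_le h1)]
    have : (v x)⁻¹ ≤ m⁻¹ := inv_anti₀ hm h1
    have : 0 ≤ M / m ^ 2 := by positivity
    linarith
  · have h1 : ∫ x in I, (-g x / v x ^ 2) ^ 2 ≤ ∫ x in I, ((m ^ 2)⁻¹ ^ 2 * g x ^ 2) := by
      refine integral_mono_ae hr.memLp.integrable_sq (h.rep.memLp.integrable_sq.const_mul _)
        (ae_volI_of_forall fun x hx => ?_)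
      have h1 := hv x hx
      simp only
      rw [div_pow, neg_sq, div_eq_inv_mul, ← inv_pow]
      gcongr
    rw [integral_const_mul] at h1
    refine h1.trans ?_
    calc (m ^ 2)⁻¹ ^ 2 * ∫ x in I, g x ^ 2 ≤ (m ^ 2)⁻¹ ^ 2 * M ^ 2 := by
          gcongr; exact h.integral_sq_le
      _ = (M / m ^ 2) ^ 2 := by rw [div_eq_inv_mul, mul_pow]
      _ ≤ _ := by
          have : 0 < m⁻¹ := by positivity
          gcongr
          linarith

end H1Bound

/-- Quotients of bounded families in `H^1(I)` and `H^2(I)` are bounded. -/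
lemma exists_quotient_bound {m : ℝ} (hm : 0 < m) (M : ℝ) : ∃ C : ℝ, 0 < C ∧
    ∀ b b₁ f f₁ : ℝ → ℝ, H1Bound M b b₁ → H1Bound M f f₁ → (∀ x ∈ Icc (-1 : ℝ) 1, m ≤ b x) →
      ∃ w₁, H1Bound C (fun x => f x / b x) w₁ ∧
        ∀ b₂ f₂, H1Bound M b₁ b₂ → H1Bound M f₁ f₂ → ∃ w₂, H1Bound C w₁ w₂ := by
  -- `R` is the bound for `1 / b`, `S` for `b₁ / b²`, and `T` for `(f / b)' = f₁ / b - b₁ f / b²`,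
  -- each in the sense of `H1Bound`. The absolute values below keep the constant positive for every
  -- real `M`.
  set R := m⁻¹ + M / m ^ 2 with hR
  set S := 2 * (M * (2 * (R * R))) with hS
  set T := 2 * (2 * (M * R) + 2 * (S * M)) with hT
  refine ⟨|2 * (M * R)| + |T| + 1, by positivity, fun b b₁ f f₁ hb hf hbm => ?_⟩
  have hr := hb.inv hm hbm
  have h1 := hf.mul hr
  have hC1 : 2 * (M * R) ≤ |2 * (M * R)| + |T| + 1 := by
    linarith [le_abs_self (2 * (M * R)), abs_nonneg T]
  have hC2 : T ≤ |2 * (M * R)| + |T| + 1 := by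
    linarith [le_abs_self T, abs_nonneg (2 * (M * R))]
  refine ⟨_, by simpa only [div_eq_mul_inv] using h1.mono hC1, fun b₂ f₂ hb₂ hf₂ => ?_⟩
  have h2 := (hb₂.mul (hr.mul hr)).neg
  have e : (fun x => -(b₁ x * ((b x)⁻¹ * (b x)⁻¹))) = fun x => -b₁ x * (b x ^ 2)⁻¹ := by
    funext x
    rw [pow_two, mul_inv]; ring
  rw [e] at h2
  have h3 := ((hf₂.mul hr).add (h2.mul hf)).mono hC2
  simp only [div_eq_mul_inv] at h3 ⊢
  exact ⟨_, h3⟩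

/-! ### Membership and norms in `H^k(I)` -/

lemma MemH.congr {k : ℕ} {u v : ℝ → ℝ} (h : MemH k u) (huv : u =ᵐ[volI] v) : MemH k v := by
  cases k with
  | zero => exact MemLp.ae_eq huv h
  | succ k =>
    obtain ⟨h1, g, h2, h3⟩ := h
    exact ⟨h1.ae_eq huv, g, h2.congr huv (EventuallyEq.refl _ _), h3⟩

lemma MemH.sub {k : ℕ} {u v : ℝ → ℝ} (hu : MemH k u) (hv : MemH k v) :
    MemH k (fun x => u x - v x) := by
  induction k generalizing u v with
  | zero => exact MemLp.sub hu hv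
  | succ k ih =>
    obtain ⟨h1, g, h2, h3⟩ := hu
    obtain ⟨h1', g', h2', h3'⟩ := hv
    exact ⟨h1.sub h1', _, h2.sub h2', ih h3 h3'⟩

lemma H1Rep.memH {v g : ℝ → ℝ} (h : H1Rep v g) {k : ℕ} (hg : MemH k g) : MemH (k + 1) v :=
  ⟨h.memLp_left, g, h.hasWeakDeriv, hg⟩

lemma HasWeakDeriv.weakDeriv {u g g₂ : ℝ → ℝ} (h : HasWeakDeriv u g) (h₂ : HasWeakDeriv g g₂) :
    HasWeakDeriv (weakDeriv u) g₂ :=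
  h₂.congr h.weakDeriv_eq.symm (EventuallyEq.refl _ _)

lemma integral_sq_congr {u v : ℝ → ℝ} (h : u =ᵐ[volI] v) :
    ∫ x in I, u x ^ 2 = ∫ x in I, v x ^ 2 :=
  integral_congr_ae (by filter_upwards [h] with x hx; rw [hx])

lemma hNorm_one_sq {u g : ℝ → ℝ} (h : HasWeakDeriv u g) :
    hNorm 1 u ^ 2 = (∫ x in I, u x ^ 2) + (∫ x in I, g x ^ 2) := by
  have hs : ∀ w : ℝ → ℝ, 0 ≤ ∫ x in I, w x ^ 2 := fun w => integral_nonneg fun x => sq_nonneg _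
  rw [hNorm, Real.sq_sqrt (Finset.sum_nonneg fun j _ => hs _)]
  simp [Finset.sum_range_succ, integral_sq_congr h.weakDeriv_eq]

lemma hNorm_two_sq {u g g₂ : ℝ → ℝ} (h : HasWeakDeriv u g) (h₂ : HasWeakDeriv g g₂) :
    hNorm 2 u ^ 2 = (∫ x in I, u x ^ 2) + (∫ x in I, g x ^ 2) + ∫ x in I, g₂ x ^ 2 := by
  have hs : ∀ w : ℝ → ℝ, 0 ≤ ∫ x in I, w x ^ 2 := fun w => integral_nonneg fun x => sq_nonneg _
  rw [hNorm, Real.sq_sqrt (Finset.sum_nonneg fun j _ => hs _)]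
  simp [Finset.sum_range_succ, integral_sq_congr h.weakDeriv_eq,
    integral_sq_congr (h.weakDeriv h₂).weakDeriv_eq]

lemma hNorm_nonneg (k : ℕ) (u : ℝ → ℝ) : 0 ≤ hNorm k u := Real.sqrt_nonneg _

lemma exists_bound_of_memH_one {u : ℝ → ℝ} {M : ℝ} (h : MemH 1 u) (hM : hNorm 1 u ≤ M) :
    ∃ v g, u =ᵐ[volI] v ∧ H1Bound (2 * M) v g := by
  obtain ⟨v, g, hv, huv⟩ := h.exists_rep
  refine ⟨v, g, huv, H1Bound.of_norm_le hv ((hNorm_nonneg _ _).trans hM) ?_⟩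
  rw [← integral_sq_congr huv,
    ← hNorm_one_sq (hv.hasWeakDeriv.congr huv.symm (EventuallyEq.refl _ _))]
  exact pow_le_pow_left₀ (hNorm_nonneg _ _) hM 2

lemma exists_bound_of_memH_two {u : ℝ → ℝ} {M : ℝ} (h : MemH 2 u) (hM : hNorm 2 u ≤ M) :
    ∃ v g g₂, u =ᵐ[volI] v ∧ H1Bound (2 * M) v g ∧ H1Bound (2 * M) g g₂ := by
  obtain ⟨_, g₀, hw, h1⟩ := h
  obtain ⟨g, g₂, hg, hgg⟩ := h1.exists_rep
  obtain ⟨v, hv, huv⟩ := hw.exists_rep h1.1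
  have hM' := pow_le_pow_left₀ (hNorm_nonneg _ _) hM 2
  have hM0 := (hNorm_nonneg _ _).trans hM
  rw [hNorm_two_sq (hw.congr (EventuallyEq.refl _ _) hgg) hg.hasWeakDeriv,
    integral_sq_congr huv] at hM'
  have hs : ∀ w : ℝ → ℝ, 0 ≤ ∫ x in I, w x ^ 2 := fun w => integral_nonneg fun x => sq_nonneg _
  exact ⟨v, g, g₂, huv, .of_norm_le (hv.congr_right hgg) hM0 (by linarith [hs g₂]),
    .of_norm_le hg hM0 (by linarith [hs v])⟩

/-- The factor 3 is generous: the squared norm is at most `3 M²` here and at most `5 M²` in the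
second order case. -/
lemma H1Bound.hNorm_one_le {u v g : ℝ → ℝ} {M : ℝ} (h : H1Bound M v g) (huv : u =ᵐ[volI] v) :
    hNorm 1 u ≤ 3 * M := by
  have hM := h.nonneg
  refine (sq_le_sq₀ (hNorm_nonneg _ _) (by positivity)).1 ?_
  rw [hNorm_one_sq (h.rep.hasWeakDeriv.congr huv.symm (EventuallyEq.refl _ _)),
    integral_sq_congr huv]
  nlinarith [h.integral_sq_le, h.integral_sq_left_le]

lemma H1Bound.hNorm_two_le {u v g g₂ : ℝ → ℝ} {M : ℝ} (h : H1Bound M v g) (h₂ : H1Bound M g g₂)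
    (huv : u =ᵐ[volI] v) : hNorm 2 u ≤ 3 * M := by
  have hM := h.nonneg
  refine (sq_le_sq₀ (hNorm_nonneg _ _) (by positivity)).1 ?_
  rw [hNorm_two_sq (h.rep.hasWeakDeriv.congr huv.symm (EventuallyEq.refl _ _))
    h₂.rep.hasWeakDeriv, integral_sq_congr huv]
  nlinarith [h₂.integral_sq_le, h.integral_sq_left_le, h₂.integral_sq_left_le]

/-! ### Traces -/

lemma eqOn_of_ae_eq {u v : ℝ → ℝ} (hu : ContinuousOn u (Icc (-1) 1))
    (hv : ContinuousOn v (Icc (-1) 1)) (h : u =ᵐ[volI] v) : EqOn u v (Icc (-1) 1) := by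
  rw [volI_eq_restrict_Icc] at h
  exact Measure.eqOn_Icc_of_ae_eq volume (by norm_num) h hu hv

lemma HasTrace.eq {u v : ℝ → ℝ} {x c : ℝ} (h : HasTrace u x c) (hx : x ∈ Icc (-1 : ℝ) 1)
    (hv : ContinuousOn v (Icc (-1) 1)) (huv : u =ᵐ[volI] v) : v x = c := by
  obtain ⟨w, hw, huw, hwc⟩ := h
  rw [← hwc]
  exact eqOn_of_ae_eq hv hw (huv.symm.trans huw) hx

lemma H1Rep.hasTrace {u v g : ℝ → ℝ} (h : H1Rep v g) (huv : u =ᵐ[volI] v) (x : ℝ) :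
    HasTrace u x (v x) := ⟨v, h.continuousOn, huv, rfl⟩

/-! ### Linear second order equations with continuous coefficients -/

lemma hasDerivAt_primitive {w : ℝ → ℝ} (hw : Continuous w) (c x : ℝ) :
    HasDerivAt (fun x => c + ∫ t in (-1 : ℝ)..x, w t) (w x) x :=
  (intervalIntegral.integral_hasDerivAt_right (hw.intervalIntegrable _ _)
    (hw.stronglyMeasurableAtFilter _ _) hw.continuousAt).const_add c

/-- In an exponentially weighted maximum norm, each integration gains a factor `1 / a`. This makes
the Picard map a contraction on the whole interval. -/
lemma abs_primitive_le {w : ℝ → ℝ} {a D x : ℝ} (ha : 0 < a) (hD : 0 ≤ D) (hx : -1 ≤ x)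
    (h : ∀ t ∈ Icc (-1) x, |w t| ≤ D * Real.exp (a * (t + 1))) :
    |∫ t in (-1 : ℝ)..x, w t| ≤ D / a * Real.exp (a * (x + 1)) := by
  have hd : ∀ t : ℝ, HasDerivAt (fun t => D / a * Real.exp (a * (t + 1)))
      (D * Real.exp (a * (t + 1))) t := fun t => by
    have h1 : HasDerivAt (fun t => a * (t + 1)) a t := by
      simpa using ((hasDerivAt_id t).add_const 1).const_mul a
    exact (h1.exp.const_mul (D / a)).congr_deriv (by field_simp)
  have hc : Continuous fun t : ℝ => D * Real.exp (a * (t + 1)) := by fun_prop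
  have h1 := intervalIntegral.norm_integral_le_of_norm_le (f := w) hx
    (Eventually.of_forall fun t ht => h t (Ioc_subset_Icc_self ht))
    (hc.intervalIntegrable (μ := volume) (-1) x)
  rw [intervalIntegral.integral_eq_sub_of_hasDerivAt (fun t _ => hd t)
    (hc.intervalIntegrable _ _)] at h1
  refine h1.trans (sub_le_self _ ?_)
  positivity

/-- `u` is twice continuously differentiable with derivatives `p` and `w`. -/
structure HasTwoDerivs (u p w : ℝ → ℝ) : Prop where
  deriv : ∀ x, HasDerivAt u (p x) x
  deriv₂ : ∀ x, HasDerivAt p (w x) x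
  cont : Continuous w

namespace HasTwoDerivs

variable {u p w u' p' w' : ℝ → ℝ}

lemma cont₁ (h : HasTwoDerivs u p w) : Continuous p :=
  continuous_iff_continuousAt.2 fun x => (h.deriv₂ x).continuousAt

lemma cont₀ (h : HasTwoDerivs u p w) : Continuous u :=
  continuous_iff_continuousAt.2 fun x => (h.deriv x).continuousAt

lemma add (h : HasTwoDerivs u p w) (h' : HasTwoDerivs u' p' w') :
    HasTwoDerivs (fun x => u x + u' x) (fun x => p x + p' x) (fun x => w x + w' x) :=
  ⟨fun x => (h.deriv x).add (h'.deriv x), fun x => (h.deriv₂ x).add (h'.deriv₂ x),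
    h.cont.add h'.cont⟩

lemma const_mul (h : HasTwoDerivs u p w) (c : ℝ) :
    HasTwoDerivs (fun x => c * u x) (fun x => c * p x) (fun x => c * w x) :=
  ⟨fun x => (h.deriv x).const_mul c, fun x => (h.deriv₂ x).const_mul c, h.cont.const_mul c⟩

lemma h1Rep (h : HasTwoDerivs u p w) : H1Rep u p := .of_hasDerivAt h.deriv h.cont₁

lemma h1Rep₂ (h : HasTwoDerivs u p w) : H1Rep p w := .of_hasDerivAt h.deriv₂ h.cont

/-- The maximum principle. -/
lemma nonneg_of_le_mul (h : HasTwoDerivs u p w) {q : ℝ → ℝ}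
    (hq : ∀ x ∈ Icc (-1 : ℝ) 1, 0 < q x) (hw : ∀ x ∈ Icc (-1 : ℝ) 1, w x ≤ q x * u x)
    (hl : 0 ≤ u (-1)) (hr : 0 ≤ u 1) : ∀ x ∈ Icc (-1 : ℝ) 1, 0 ≤ u x := by
  obtain ⟨y, hy, hmin⟩ := isCompact_Icc.exists_isMinOn (⟨0, by simp⟩ : (Icc (-1 : ℝ) 1).Nonempty)
    h.cont₀.continuousOn
  suffices 0 ≤ u y from fun x hx => this.trans (hmin hx)
  by_contra! hneg
  have hy1 : y ≠ -1 := by rintro rfl; linarith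
  have hy2 : y ≠ 1 := by rintro rfl; linarith
  have hyI : Icc (-1 : ℝ) 1 ∈ nhds y :=
    Icc_mem_nhds (lt_of_le_of_ne hy.1 hy1.symm) (lt_of_le_of_ne hy.2 hy2)
  have hloc : IsLocalMin u y := hmin.isLocalMin hyI
  have hw0 : w y < 0 := (hw y hy).trans_lt (mul_neg_of_pos_of_neg (hq y hy) hneg)
  have hd : _root_.deriv u = p := funext fun x => (h.deriv x).deriv
  -- A negative second derivative at a critical point makes the minimum also a local maximum. Then
  -- `u` is constant near `y`, which forces `w y = 0`.
  have hmax : IsLocalMax u y := isLocalMax_of_deriv_deriv_neg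
    (by rw [hd, (h.deriv₂ y).deriv]; exact hw0) hloc.deriv_eq_zero (h.deriv y).continuousAt
  have hconst : u =ᶠ[nhds y] fun _ => u y := by
    filter_upwards [hloc, hmax] with x h1 h2 using le_antisymm h2 h1
  have h2 := hconst.deriv.deriv_eq
  rw [hd, (h.deriv₂ y).deriv] at h2
  simp at h2
  linarith

end HasTwoDerivs

/-- Picard's fixed point for `u'' = q u + h` in the unknown `z = exp (-a (x + 1)) u`. Two
integrations make the Lipschitz constant `Q / a²`, so no restriction on the length of the interval
is needed. -/
lemma exists_initial_value {q h : ℝ → ℝ} (hq : Continuous q) (hh : Continuous h) (c₀ c₁ : ℝ) :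
    ∃ u p w, HasTwoDerivs u p w ∧ u (-1) = c₀ ∧ p (-1) = c₁ ∧
      ∀ x ∈ Icc (-1 : ℝ) 1, w x = q x * u x + h x := by
  obtain ⟨Q, hQ⟩ := isCompact_Icc.exists_bound_of_continuousOn (hq.continuousOn (s := Icc (-1) 1))
  have hQ0 : 0 ≤ Q := (norm_nonneg _).trans (hQ 0 (by simp))
  -- This choice gives `Q / a² ≤ 1 / 2`, also when `Q = 0`.
  set a := 2 * Q + 1 with ha
  have ha1 : 1 ≤ a := by linarith
  have ha0 : 0 < a := by linarith
  have hle : (-1 : ℝ) ≤ 1 := by norm_num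
  let W : C(Icc (-1 : ℝ) 1, ℝ) → ℝ → ℝ := fun z t =>
    q t * (Real.exp (a * (t + 1)) * IccExtend hle z t) + h t
  have hW : ∀ z, Continuous (W z) := fun z => by
    have : Continuous (IccExtend hle z) := z.continuous.Icc_extend'
    fun_prop
  let P : C(Icc (-1 : ℝ) 1, ℝ) → ℝ → ℝ := fun z s => c₁ + ∫ t in (-1 : ℝ)..s, W z t
  have hPd : ∀ z s, HasDerivAt (P z) (W z s) s := fun z s => hasDerivAt_primitive (hW z) c₁ s
  have hP : ∀ z, Continuous (P z) := fun z =>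
    continuous_iff_continuousAt.2 fun x => (hPd z x).continuousAt
  let U : C(Icc (-1 : ℝ) 1, ℝ) → ℝ → ℝ := fun z s => c₀ + ∫ t in (-1 : ℝ)..s, P z t
  have hUd : ∀ z s, HasDerivAt (U z) (P z s) s := fun z s => hasDerivAt_primitive (hP z) c₀ s
  have hU : ∀ z, Continuous (U z) := fun z =>
    continuous_iff_continuousAt.2 fun x => (hUd z x).continuousAt
  let T : C(Icc (-1 : ℝ) 1, ℝ) → C(Icc (-1 : ℝ) 1, ℝ) := fun z =>
    ⟨fun x => Real.exp (-(a * (x + 1))) * U z x, by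
      have := hU z
      fun_prop⟩
  have hT : ContractingWith (1 / 2) T := by
    refine ⟨by rw [← NNReal.coe_lt_coe]; norm_num, LipschitzWith.of_dist_le_mul fun z z' => ?_⟩
    have hd0 : 0 ≤ dist z z' := dist_nonneg
    rw [ContinuousMap.dist_le (by positivity)]
    intro x
    have hWd : ∀ t ∈ Icc (-1 : ℝ) 1,
        |W z t - W z' t| ≤ Q * dist z z' * Real.exp (a * (t + 1)) := by
      intro t ht
      have e : W z t - W z' t = q t * (Real.exp (a * (t + 1)) * (z ⟨t, ht⟩ - z' ⟨t, ht⟩)) := by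
        simp only [W, IccExtend_of_mem hle _ ht]; ring
      rw [e, abs_mul, abs_mul, Real.abs_exp]
      have h1 : |z ⟨t, ht⟩ - z' ⟨t, ht⟩| ≤ dist z z' :=
        (Real.dist_eq _ _).symm.trans_le (ContinuousMap.dist_apply_le_dist _)
      have h2 : |q t| ≤ Q := hQ t ht
      calc |q t| * (Real.exp (a * (t + 1)) * |z ⟨t, ht⟩ - z' ⟨t, ht⟩|)
          ≤ Q * (Real.exp (a * (t + 1)) * dist z z') := by gcongr
        _ = _ := by ring
    have hPdd : ∀ s ∈ Icc (-1 : ℝ) 1,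
        |P z s - P z' s| ≤ Q * dist z z' / a * Real.exp (a * (s + 1)) := by
      intro s hs
      have e : P z s - P z' s = ∫ t in (-1 : ℝ)..s, (W z t - W z' t) := by
        rw [intervalIntegral.integral_sub ((hW z).intervalIntegrable _ _)
          ((hW z').intervalIntegrable _ _)]
        simp only [P]; ring
      rw [e]
      exact abs_primitive_le ha0 (by positivity) hs.1
        fun t ht => hWd t (Icc_subset_Icc_right hs.2 ht)
    have hUdd : |U z x - U z' x| ≤ Q * dist z z' / a / a * Real.exp (a * (x + 1)) := by
      have e : U z x - U z' x = ∫ t in (-1 : ℝ)..x, (P z t - P z' t) := by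
        rw [intervalIntegral.integral_sub ((hP z).intervalIntegrable _ _)
          ((hP z').intervalIntegrable _ _)]
        simp only [U]; ring
      rw [e]
      exact abs_primitive_le ha0 (by positivity) x.2.1
        fun t ht => hPdd t (Icc_subset_Icc_right x.2.2 ht)
    have e : dist (T z x) (T z' x) = Real.exp (-(a * (x + 1))) * |U z x - U z' x| := by
      simp only [T, Real.dist_eq, ContinuousMap.coe_mk]
      rw [← mul_sub, abs_mul, Real.abs_exp]
    rw [e]
    calc Real.exp (-(a * (x + 1))) * |U z x - U z' x|
        ≤ Real.exp (-(a * (x + 1))) * (Q * dist z z' / a / a * Real.exp (a * (x + 1))) := by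
          gcongr
      _ = Q / a / a * dist z z' := by
          rw [Real.exp_neg]; field_simp
      _ ≤ _ := by
          gcongr
          simp only [NNReal.coe_div, NNReal.coe_one, NNReal.coe_ofNat]
          rw [div_div, div_le_div_iff₀ (by positivity) (by norm_num)]
          nlinarith
  obtain ⟨z, hz⟩ : ∃ z, T z = z := ⟨_, hT.fixedPoint_isFixedPt⟩
  refine ⟨U z, P z, W z, ⟨hUd z, hPd z, hW z⟩, by simp [U], by simp [P], fun x hx => ?_⟩
  have h1 : Real.exp (-(a * (x + 1))) * U z x = z ⟨x, hx⟩ := congrArg (fun f => f ⟨x, hx⟩) hz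
  simp only [W, IccExtend_of_mem hle _ hx, ← h1, Real.exp_neg]
  field_simp

/-- Solvability of the two point boundary value problem, by shooting. -/
lemma exists_boundary_value {q h : ℝ → ℝ} (hq : Continuous q) (hh : Continuous h)
    (hpos : ∀ x ∈ Icc (-1 : ℝ) 1, 0 < q x) (l r : ℝ) :
    ∃ u p w, HasTwoDerivs u p w ∧ u (-1) = l ∧ u 1 = r ∧
      ∀ x ∈ Icc (-1 : ℝ) 1, w x = q x * u x + h x := by
  obtain ⟨u₁, p₁, w₁, h₁, hu₁, hp₁, hw₁⟩ := exists_initial_value hq continuous_zero 0 1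
  obtain ⟨u₂, p₂, w₂, h₂, hu₂, hp₂, hw₂⟩ := exists_initial_value hq hh l 0
  -- Shooting fails only if the homogeneous solution with slope one at `-1` returns to zero at `1`.
  -- The maximum principle for `± u₁` would then make it vanish on `[-1, 1]`, contradicting the
  -- slope.
  have hne : u₁ 1 ≠ 0 := by
    intro h0
    have hz : ∀ x ∈ Icc (-1 : ℝ) 1, u₁ x = 0 := fun x hx => by
      refine le_antisymm ?_ (h₁.nonneg_of_le_mul hpos (fun y hy => by simp [hw₁ y hy]) hu₁.ge
        h0.ge x hx)
      have := (h₁.const_mul (-1)).nonneg_of_le_mul hpos (fun y hy => by simp [hw₁ y hy])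
        (by simp [hu₁]) (by simp [h0]) x hx
      linarith
    have hd : HasDerivWithinAt u₁ 0 (Icc (-1) 1) (-1) :=
      (hasDerivWithinAt_const (-1 : ℝ) (Icc (-1) 1) (0 : ℝ)).congr hz (hz _ (by simp))
    have := (uniqueDiffOn_Icc (by norm_num : (-1 : ℝ) < 1) (-1) (by simp)).eq_deriv _ hd
      (h₁.deriv (-1)).hasDerivWithinAt
    rw [hp₁] at this
    norm_num at this
  refine ⟨_, _, _, h₂.add (h₁.const_mul ((r - u₂ 1) / u₁ 1)), by simp [hu₁, hu₂], ?_,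
    fun x hx => ?_⟩
  · field_simp; ring
  · simp only [hw₁ x hx, hw₂ x hx, Pi.zero_apply]; ring

/-! ### The boundary value problem -/

/-- The continuous functions `max m v` and `v` agree almost everywhere, hence everywhere on `[-1,
1]`. -/
lemma le_of_ae_le {v : ℝ → ℝ} {m : ℝ} (hv : ContinuousOn v (Icc (-1) 1))
    (h : ∀ᵐ x ∂volI, m ≤ v x) : ∀ x ∈ Icc (-1 : ℝ) 1, m ≤ v x := by
  intro x hx
  have := eqOn_of_ae_eq (u := fun x => max m (v x)) (continuousOn_const.sup hv) hv
    (by filter_upwards [h] with y hy using max_eq_right hy) hx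
  exact max_eq_right_iff.1 this

/-- `u` is a classical solution of `-ε² u'' + b u = g` on `[-1, 1]`, with derivatives `p`, `w`. -/
structure IsClassicalSolution (ε : ℝ) (b g u p w : ℝ → ℝ) : Prop where
  derivs : HasTwoDerivs u p w
  eqn : ∀ x ∈ Icc (-1 : ℝ) 1, ε ^ 2 * w x = b x * u x - g x

lemma exists_isClassicalSolution {ε m : ℝ} (hε : 0 < ε) (hm : 0 < m) {b g : ℝ → ℝ}
    (hb : ContinuousOn b (Icc (-1) 1)) (hg : ContinuousOn g (Icc (-1) 1))
    (hbm : ∀ x ∈ Icc (-1 : ℝ) 1, m ≤ b x) (l r : ℝ) :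
    ∃ u p w, IsClassicalSolution ε b g u p w ∧ u (-1) = l ∧ u 1 = r := by
  -- Composition with the projection `c` onto `[-1, 1]` extends the coefficients continuously to the
  -- line.
  let c : ℝ → ℝ := fun x => max (-1) (min x 1)
  have hc : Continuous c := by fun_prop
  have hcI : ∀ x, c x ∈ Icc (-1 : ℝ) 1 := fun x =>
    ⟨le_max_left _ _, max_le (by norm_num) (min_le_right _ _)⟩
  have hcx : ∀ x ∈ Icc (-1 : ℝ) 1, c x = x := fun x hx => by
    simp only [c, min_eq_left hx.2, max_eq_right hx.1]
  obtain ⟨u, p, w, h, hl, hr, hw⟩ := exists_boundary_value (q := fun x => b (c x) / ε ^ 2)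
    (h := fun x => -(g (c x) / ε ^ 2)) ((hb.comp_continuous hc hcI).div_const _)
    ((hg.comp_continuous hc hcI).div_const _).neg
    (fun x _ => div_pos (hm.trans_le (hbm _ (hcI x))) (by positivity)) l r
  refine ⟨u, p, w, ⟨h, fun x hx => ?_⟩, hl, hr⟩
  rw [hw x hx, hcx x hx]
  field_simp
  ring

lemma memH_of_le {j k : ℕ} (hjk : j ≤ k) {u : ℝ → ℝ} (h : MemH k u) : MemH j u := by
  induction j generalizing k u with
  | zero =>
    cases k with
    | zero => exact h
    | succ k => exact h.1
  | succ j ih =>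
    cases k with
    | zero => omega
    | succ k =>
      obtain ⟨h1, g, h2, h3⟩ := h
      exact ⟨h1, g, h2, ih (by omega) h3⟩

/-- The bilinear form `∫_I (ε² g g' + b v v')` for representatives `v`, `v'` with derivatives
`g`, `g'`. -/
noncomputable def energyForm (ε : ℝ) (b v g v' g' : ℝ → ℝ) : ℝ :=
  ε ^ 2 * (∫ x in I, g x * g' x) + ∫ x in I, b x * v x * v' x

lemma integrable_mul_of_memLp {f g : ℝ → ℝ} (hf : MemLp f 2 volI) (hg : MemLp g 2 volI) :
    Integrable (fun x => f x * g x) volI :=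
  hf.integrable_mul hg

lemma integrable_triple {b v d : ℝ → ℝ} (hb : ContinuousOn b (Icc (-1) 1))
    (hv : ContinuousOn v (Icc (-1) 1)) (hd : ContinuousOn d (Icc (-1) 1)) :
    Integrable (fun x => b x * v x * d x) volI :=
  (memLp_volI_of_continuousOn (p := 2) ((hb.mul hv).mul hd)).integrable one_le_two

lemma integral_form {ε : ℝ} {b v g v' g' : ℝ → ℝ} (hb : ContinuousOn b (Icc (-1) 1))
    (h : H1Rep v g) (h' : H1Rep v' g') :
    ∫ x in I, (ε ^ 2 * (g x * g' x) + b x * v x * v' x) = energyForm ε b v g v' g' := by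
  rw [energyForm, ← integral_const_mul]
  exact integral_add ((integrable_mul_of_memLp h.memLp h'.memLp).const_mul _)
    (integrable_triple hb h.continuousOn h'.continuousOn)

lemma energyForm_sub {ε : ℝ} {b v g v' g' d d₁ : ℝ → ℝ} (hb : ContinuousOn b (Icc (-1) 1))
    (h : H1Rep v g) (h' : H1Rep v' g') (hd : H1Rep d d₁) :
    energyForm ε b (fun x => v x - v' x) (fun x => g x - g' x) d d₁ =
      energyForm ε b v g d d₁ - energyForm ε b v' g' d d₁ := by
  rw [← integral_form hb h hd, ← integral_form hb h' hd, ← integral_form hb (h.sub h') hd,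
    ← integral_sub]
  · congr 1 with x
    ring
  · exact ((integrable_mul_of_memLp h.memLp hd.memLp).const_mul _).add
      (integrable_triple hb h.continuousOn hd.continuousOn)
  · exact ((integrable_mul_of_memLp h'.memLp hd.memLp).const_mul _).add
      (integrable_triple hb h'.continuousOn hd.continuousOn)

/-- Coercivity. The `L²` term yields uniqueness and the rate for `k = 2`; the derivative term yields
the rate for `k = 1`. -/
lemma energyForm_self_bounds {ε m : ℝ} {b d d₁ : ℝ → ℝ} (hb : ContinuousOn b (Icc (-1) 1))
    (hbm : ∀ x ∈ Icc (-1 : ℝ) 1, m ≤ b x) (hd : H1Rep d d₁) :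
    ε ^ 2 * (∫ x in I, d₁ x ^ 2) + m * (∫ x in I, d x ^ 2) ≤ energyForm ε b d d₁ d d₁ := by
  have e5 : ∫ x in I, m * d x ^ 2 ≤ ∫ x in I, b x * d x * d x := by
    refine integral_mono_ae (hd.memLp_left.integrable_sq.const_mul _)
      (integrable_triple hb hd.continuousOn hd.continuousOn)
      (ae_volI_of_forall fun x hx => ?_)
    have := hbm x hx
    simp only
    nlinarith [sq_nonneg (d x)]
  rw [integral_const_mul] at e5
  simp only [energyForm, ← pow_two]
  linarith

lemma bilin_eq {ε : ℝ} {b b' u v g u' v' g' : ℝ → ℝ} (hbb : b =ᵐ[volI] b')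
    (hb : ContinuousOn b' (Icc (-1) 1)) (h : H1Rep v g) (hu : u =ᵐ[volI] v) (h' : H1Rep v' g')
    (hu' : u' =ᵐ[volI] v') :
    bilin ε b u u' = energyForm ε b' v g v' g' := by
  rw [← integral_form hb h h', bilin]
  refine integral_congr_ae ?_
  filter_upwards [hbb, hu, hu',
    (h.hasWeakDeriv.congr hu.symm (EventuallyEq.refl _ _)).weakDeriv_eq,
    (h'.hasWeakDeriv.congr hu'.symm (EventuallyEq.refl _ _)).weakDeriv_eq] with x e1 e2 e3 e4 e5
  rw [e1, e2, e3, e4, e5]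

lemma energyNorm_eq {ε : ℝ} {b b' u v g : ℝ → ℝ} (hbb : b =ᵐ[volI] b')
    (hb : ContinuousOn b' (Icc (-1) 1)) (h : H1Rep v g) (hu : u =ᵐ[volI] v) :
    energyNorm ε b u = √(energyForm ε b' v g v g) := by
  rw [← bilin_eq hbb hb h hu h hu, energyNorm, bilin]
  simp only [pow_two, mul_assoc]

lemma MemH10.exists_rep {v : ℝ → ℝ} (hv : MemH10 v) :
    ∃ d d₁, H1Rep d d₁ ∧ v =ᵐ[volI] d ∧ d (-1) = 0 ∧ d 1 = 0 := by
  obtain ⟨d, d₁, hd, hvd⟩ := hv.1.exists_rep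
  exact ⟨d, d₁, hd, hvd, hv.2.1.eq (by simp) hd.continuousOn hvd,
    hv.2.2.eq (by simp) hd.continuousOn hvd⟩

namespace IsClassicalSolution

variable {ε m : ℝ} {b b' g g' u p w : ℝ → ℝ}

/-- The weak form of the equation. -/
lemma weak_form (h : IsClassicalSolution ε b g u p w) (hb : ContinuousOn b (Icc (-1) 1))
    {d d₁ : ℝ → ℝ} (hd : H1Rep d d₁) (hl : d (-1) = 0) (hr : d 1 = 0) :
    energyForm ε b u p d d₁ = ∫ x in I, g x * d x := by
  rw [energyForm, h.derivs.h1Rep₂.integral_mul_right hd, hl, hr]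
  have e : ∫ x in I, g x * d x = ∫ x in I, (b x * u x * d x - ε ^ 2 * (w x * d x)) := by
    refine integral_congr_ae (ae_volI_of_forall fun x hx => ?_)
    have := h.eqn x hx
    simp only
    linear_combination d x * this
  rw [e, integral_sub, integral_const_mul]
  · ring
  · exact integrable_triple hb h.derivs.cont₀.continuousOn hd.continuousOn
  · exact (integrable_mul_of_memLp (memLp_volI_of_continuousOn h.derivs.cont.continuousOn)
      hd.memLp_left).const_mul _

/-- For uniqueness, the difference `d` of two solutions is itself an admissible test function, so
its energy is zero and coercivity gives `∫ d² = 0`. -/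
lemma isTheWeakSolution (h : IsClassicalSolution ε b g u p w) (hm : 0 < m)
    (hb : ContinuousOn b (Icc (-1) 1)) (hbm : ∀ x ∈ Icc (-1 : ℝ) 1, m ≤ b x)
    (hbb : b' =ᵐ[volI] b) (hgg : g' =ᵐ[volI] g) :
    IsTheWeakSolution ε b' g' (u (-1)) (u 1) u := by
  have hur := h.derivs.h1Rep
  have hgd : ∀ v d : ℝ → ℝ, v =ᵐ[volI] d → ∫ x in I, g' x * v x = ∫ x in I, g x * d x :=
    fun v d hvd => integral_congr_ae (by filter_upwards [hgg, hvd] with x e1 e2; rw [e1, e2])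
  refine ⟨⟨hur.memH (k := 0) hur.memLp, hur.hasTrace (EventuallyEq.refl _ _) _,
    hur.hasTrace (EventuallyEq.refl _ _) _, fun v hv => ?_⟩, fun v hv => ?_⟩
  · obtain ⟨d, d₁, hd, hvd, hl, hr⟩ := hv.exists_rep
    rw [bilin_eq hbb hb hur (EventuallyEq.refl _ _) hd hvd, h.weak_form hb hd hl hr, hgd v d hvd]
  · obtain ⟨hv1, hvl, hvr, hvw⟩ := hv
    obtain ⟨z, z₁, hz, hvz⟩ := hv1.exists_rep
    have hd := hz.sub hur
    have hl : z (-1) - u (-1) = 0 :=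
      sub_eq_zero.2 (hvl.eq (by simp) hz.continuousOn hvz)
    have hr : z 1 - u 1 = 0 := sub_eq_zero.2 (hvr.eq (by simp) hz.continuousOn hvz)
    set d : ℝ → ℝ := fun x => z x - u x with hdd
    have hd10 : MemH10 d := ⟨hd.memH (k := 0) hd.memLp,
      hl ▸ hd.hasTrace (EventuallyEq.refl _ _) (-1), hr ▸ hd.hasTrace (EventuallyEq.refl _ _) 1⟩
    have e1 := hvw d hd10
    rw [bilin_eq hbb hb hz hvz hd (EventuallyEq.refl _ _), hgd d d (EventuallyEq.refl _ _),
      ← h.weak_form hb hd hl hr] at e1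
    have e2 := energyForm_sub (ε := ε) hb hz hur hd
    rw [e1, sub_self] at e2
    have e3 := (energyForm_self_bounds (ε := ε) hb hbm hd).trans_eq e2
    have e4 : 0 ≤ ∫ x in I, (z₁ x - p x) ^ 2 := integral_nonneg fun x => sq_nonneg _
    have e6 : 0 ≤ ∫ x in I, d x ^ 2 := integral_nonneg fun x => sq_nonneg _
    have e7 : ∫ x in I, d x ^ 2 = 0 := by
      nlinarith [mul_nonneg (sq_nonneg ε) e4]
    have e8 := (integral_eq_zero_iff_of_nonneg (fun x => sq_nonneg (d x))
      hd.memLp_left.integrable_sq).1 e7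
    filter_upwards [e8, hvz] with x h1 h2
    have h3 : d x = 0 := by simpa using h1
    rw [h2]
    exact sub_eq_zero.1 h3

/-- On `[-1, 1]` the second derivative equals `(b u - g) / ε²`, which inherits `H^1` regularity from
the data. -/
lemma memH_three (h : IsClassicalSolution ε b g u p w) (hε : ε ≠ 0) {b₁ g₁ : ℝ → ℝ}
    (hb : H1Rep b b₁) (hg : H1Rep g g₁) : MemH 3 u := by
  have h1 := (((hb.mul h.derivs.h1Rep).sub hg).const_mul (ε ^ 2)⁻¹).congr_left (v' := w)
    fun x hx => by simp only [← h.eqn x hx]; field_simp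
  exact h.derivs.h1Rep.memH (h.derivs.h1Rep₂.memH (h1.memH (k := 0) h1.memLp))

/-- Comparison with an exponential barrier. -/
lemma abs_le_exp (h : IsClassicalSolution ε b (fun _ => 0) u p w) (hε : 0 < ε)
    {s A x₀ : ℝ} (hA : 0 ≤ A) (hbpos : ∀ x ∈ Icc (-1 : ℝ) 1, 0 < b x)
    (hs : ∀ x ∈ Icc (-1 : ℝ) 1, ε ^ 2 * s ^ 2 ≤ b x)
    (hl : |u (-1)| ≤ A * Real.exp (s * (-1 - x₀))) (hr : |u 1| ≤ A * Real.exp (s * (1 - x₀))) :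
    ∀ x ∈ Icc (-1 : ℝ) 1, |u x| ≤ A * Real.exp (s * (x - x₀)) := by
  have hd : ∀ B x : ℝ, HasDerivAt (fun x => B * Real.exp (s * (x - x₀)))
      (B * s * Real.exp (s * (x - x₀))) x := fun B x => by
    have h1 : HasDerivAt (fun x => s * (x - x₀)) s x := by
      simpa using ((hasDerivAt_id x).sub_const x₀).const_mul s
    exact (h1.exp.const_mul B).congr_deriv (by ring)
  have hψ : HasTwoDerivs (fun x => A * Real.exp (s * (x - x₀)))
      (fun x => A * s * Real.exp (s * (x - x₀))) (fun x => A * s * s * Real.exp (s * (x - x₀))) :=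
    ⟨hd A, hd (A * s), by fun_prop⟩
  -- Since `ε² s² ≤ b`, the exponential `ψ` satisfies `ε² ψ'' ≤ b ψ`, so the maximum principle
  -- applies to `ψ + σ u` with `σ = ± 1`.
  have key : ∀ σ : ℝ, |σ| = 1 → ∀ x ∈ Icc (-1 : ℝ) 1,
      0 ≤ A * Real.exp (s * (x - x₀)) + σ * u x := by
    intro σ hσ
    have hσ' : ∀ y, -|y| ≤ σ * y := fun y => by
      have := neg_abs_le (σ * y)
      rwa [abs_mul, hσ, one_mul] at this
    refine (hψ.add (h.derivs.const_mul σ)).nonneg_of_le_mul (q := fun x => b x / ε ^ 2)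
      (fun x hx => div_pos (hbpos x hx) (by positivity)) (fun x hx => ?_)
      (by linarith [hσ' (u (-1))]) (by linarith [hσ' (u 1)])
    have h1 : w x = b x / ε ^ 2 * u x := by
      have := h.eqn x hx
      field_simp
      linarith
    have h2 : s * s ≤ b x / ε ^ 2 := by
      rw [le_div_iff₀ (by positivity)]
      linarith [hs x hx]
    have h3 : 0 ≤ A * Real.exp (s * (x - x₀)) := by positivity
    simp only [h1]
    nlinarith
  intro x hx
  have h1 := key 1 (by simp) x hx
  have h2 := key (-1) (by simp) x hx
  rw [abs_le]
  constructor <;> linarith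

end IsClassicalSolution

lemma weightedNorm_le {W v w : ℝ → ℝ} {c D : ℝ} (hc : 0 ≤ c) (hvw : v =ᵐ[volI] w)
    (hD : ∀ x ∈ Icc (-1 : ℝ) 1, |c * w x * W x| ≤ D) : c * weightedNorm W v ≤ 2 * D := by
  have hD0 : 0 ≤ D := (abs_nonneg _).trans (hD 0 (by simp))
  rw [weightedNorm, ← Real.sqrt_sq hc, ← Real.sqrt_mul (sq_nonneg c), ← integral_const_mul]
  refine Real.sqrt_le_iff.2 ⟨by positivity, ?_⟩
  calc ∫ x in I, c ^ 2 * (v x ^ 2 * W x ^ 2) ≤ ∫ _ in I, D ^ 2 := by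
        refine integral_mono_of_nonneg (Eventually.of_forall fun x => by positivity)
          (integrable_const _) ?_
        filter_upwards [hvw, ae_volI_of_forall hD] with x h1 h2
        rw [h1, ← mul_pow, ← mul_pow, ← mul_assoc]
        exact sq_le_sq' (abs_le.1 h2).1 (abs_le.1 h2).2
    _ = 2 * D ^ 2 := integral_volI_const _
    _ ≤ _ := by nlinarith

/-! ### The remainder and the boundary layers -/

/-- The remainder of the expansion solves the equation with right-hand side `ε² z''`. -/
lemma energyForm_remainder {ε : ℝ} {b f u p w uₘ pₘ wₘ uₚ pₚ wₚ z z₁ : ℝ → ℝ}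
    (hb : ContinuousOn b (Icc (-1) 1)) (h : IsClassicalSolution ε b f u p w)
    (hM : IsClassicalSolution ε b (fun _ => 0) uₘ pₘ wₘ)
    (hP : IsClassicalSolution ε b (fun _ => 0) uₚ pₚ wₚ) (hz : H1Rep z z₁)
    (hbz : ∀ x ∈ Icc (-1 : ℝ) 1, b x * z x = f x)
    {d d₁ : ℝ → ℝ} (hd : H1Rep d d₁) (hl : d (-1) = 0) (hr : d 1 = 0) :
    energyForm ε b (fun x => u x - z x - uₘ x - uₚ x) (fun x => p x - z₁ x - pₘ x - pₚ x) d d₁ =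
      -(ε ^ 2 * ∫ x in I, z₁ x * d₁ x) := by
  have h1 := h.derivs.h1Rep.sub hz
  rw [energyForm_sub hb (h1.sub hM.derivs.h1Rep) hP.derivs.h1Rep hd,
    energyForm_sub hb h1 hM.derivs.h1Rep hd, energyForm_sub hb h.derivs.h1Rep hz hd,
    h.weak_form hb hd hl hr, hM.weak_form hb hd hl hr, hP.weak_form hb hd hl hr, energyForm]
  have e : ∫ x in I, b x * z x * d x = ∫ x in I, f x * d x :=
    integral_congr_ae (ae_volI_of_forall fun x hx => by simp only [hbz x hx])
  rw [e]
  simp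

/-- The case `k = 1`: coercivity gives `‖d₁‖ ≤ √E / ε`, so one power of `ε` is lost and `E ≤ C ε
√E`. Division by `√E` finishes, the case `√E = 0` being trivial. -/
lemma sqrt_energyForm_le {ε m C : ℝ} {b d d₁ z₁ : ℝ → ℝ} (hε : 0 < ε) (hm : 0 < m) (hC : 0 ≤ C)
    (hb : ContinuousOn b (Icc (-1) 1)) (hbm : ∀ x ∈ Icc (-1 : ℝ) 1, m ≤ b x) (hd : H1Rep d d₁)
    (hE : energyForm ε b d d₁ d d₁ = -(ε ^ 2 * ∫ x in I, z₁ x * d₁ x)) (hz : MemLp z₁ 2 volI)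
    (hzC : ∫ x in I, z₁ x ^ 2 ≤ C ^ 2) : √(energyForm ε b d d₁ d d₁) ≤ C * ε := by
  have hB := energyForm_self_bounds (ε := ε) hb hbm hd
  set E := energyForm ε b d d₁ d d₁
  have h1 : 0 ≤ ∫ x in I, d₁ x ^ 2 := integral_nonneg fun x => sq_nonneg _
  have h2 : 0 ≤ ∫ x in I, d x ^ 2 := integral_nonneg fun x => sq_nonneg _
  have hE0 : 0 ≤ E := le_trans (by positivity) hB
  have hd₁ : ∫ x in I, d₁ x ^ 2 ≤ (√E / ε) ^ 2 := by
    rw [div_pow, Real.sq_sqrt hE0, le_div_iff₀ (by positivity)]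
    nlinarith [mul_nonneg hm.le h2]
  have h3 := abs_integral_mul_le hz hd.memLp hC (by positivity) hzC hd₁
  have h4 : √E * √E ≤ (C * ε) * √E := by
    rw [Real.mul_self_sqrt hE0]
    calc E ≤ ε ^ 2 * |∫ x in I, z₁ x * d₁ x| := by
          rw [hE]
          nlinarith [neg_abs_le (∫ x in I, z₁ x * d₁ x), sq_nonneg ε]
      _ ≤ ε ^ 2 * (C * (√E / ε)) := by gcongr
      _ = _ := by field_simp
  rcases (Real.sqrt_nonneg E).eq_or_lt with h5 | h5
  · rw [← h5]; positivity
  · exact le_of_mul_le_mul_right h4 h5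

/-- The case `k = 2`: as `d` vanishes at the endpoints, the derivative moves onto `z₁`, and `‖d‖ ≤
√E / √m` costs a factor `1 / √m` in place of `1 / ε`. -/
lemma sqrt_energyForm_le_sq {ε m C : ℝ} {b d d₁ z₁ z₂ : ℝ → ℝ} (hm : 0 < m)
    (hC : 0 ≤ C) (hb : ContinuousOn b (Icc (-1) 1)) (hbm : ∀ x ∈ Icc (-1 : ℝ) 1, m ≤ b x)
    (hd : H1Rep d d₁) (hl : d (-1) = 0) (hr : d 1 = 0)
    (hE : energyForm ε b d d₁ d d₁ = -(ε ^ 2 * ∫ x in I, z₁ x * d₁ x)) (hz : H1Rep z₁ z₂)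
    (hzC : ∫ x in I, z₂ x ^ 2 ≤ C ^ 2) : √(energyForm ε b d d₁ d d₁) ≤ C / √m * ε ^ 2 := by
  have hB := energyForm_self_bounds (ε := ε) hb hbm hd
  rw [hz.integral_mul_right hd, hl, hr] at hE
  set E := energyForm ε b d d₁ d d₁
  have h1 : 0 ≤ ∫ x in I, d₁ x ^ 2 := integral_nonneg fun x => sq_nonneg _
  have h2 : 0 ≤ ∫ x in I, d x ^ 2 := integral_nonneg fun x => sq_nonneg _
  have hE0 : 0 ≤ E := le_trans (by positivity) hB
  have hd₁ : ∫ x in I, d x ^ 2 ≤ (√E / √m) ^ 2 := by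
    rw [div_pow, Real.sq_sqrt hE0, Real.sq_sqrt hm.le, le_div_iff₀ hm]
    nlinarith [mul_nonneg (sq_nonneg ε) h1]
  have h3 := abs_integral_mul_le hz.memLp hd.memLp_left hC (by positivity) hzC hd₁
  have h4 : √E * √E ≤ (C / √m * ε ^ 2) * √E := by
    rw [Real.mul_self_sqrt hE0]
    calc E = ε ^ 2 * ∫ x in I, z₂ x * d x := by rw [hE]; ring
      _ ≤ ε ^ 2 * |∫ x in I, z₂ x * d x| := by gcongr; exact le_abs_self _
      _ ≤ ε ^ 2 * (C * (√E / √m)) := by gcongr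
      _ = _ := by field_simp
  rcases (Real.sqrt_nonneg E).eq_or_lt with h5 | h5
  · rw [← h5]; positivity
  · exact le_of_mul_le_mul_right h4 h5

/-- The weighted bound for the second derivative of a boundary layer at the endpoint `x₀ = ∓1`,
where `s = ±√m / ε`. -/
lemma boundaryLayer_bound {ε m M A s x₀ : ℝ} {b u p w W : ℝ → ℝ} (hε : 0 < ε) (hm : 0 < m)
    (h : IsClassicalSolution ε b (fun _ => 0) u p w)
    (hbm : ∀ x ∈ Icc (-1 : ℝ) 1, m ≤ b x) (hbM : ∀ x ∈ Icc (-1 : ℝ) 1, |b x| ≤ M)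
    (hA : 0 ≤ A) (hs : ε ^ 2 * s ^ 2 = m)
    (hs0 : ∀ x ∈ Icc (-1 : ℝ) 1, s * (x - x₀) ≤ 0)
    (hW : ∀ x, W x = Real.exp (-(s * (x - x₀)) / 2))
    (hl : |u (-1)| ≤ A * Real.exp (s * (-1 - x₀))) (hr : |u 1| ≤ A * Real.exp (s * (1 - x₀))) :
    ε ^ 2 * weightedNorm W (weakDeriv (weakDeriv u)) ≤ 2 * (M * A) := by
  have hM : 0 ≤ M := (abs_nonneg _).trans (hbM 0 (by simp))
  have hd := h.abs_le_exp hε hA (fun x hx => hm.trans_le (hbm x hx))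
    (fun x hx => hs.le.trans (hbm x hx)) hl hr
  have hu := h.derivs.h1Rep.hasWeakDeriv.weakDeriv h.derivs.h1Rep₂.hasWeakDeriv
  refine weightedNorm_le (sq_nonneg ε) hu.weakDeriv_eq fun x hx => ?_
  rw [h.eqn x hx, sub_zero, abs_mul, abs_mul, hW, Real.abs_exp]
  -- The weight takes back only half of the decay exponent.
  have h1 : Real.exp (s * (x - x₀)) * Real.exp (-(s * (x - x₀)) / 2) ≤ 1 := by
    rw [← Real.exp_add, Real.exp_le_one_iff]
    linarith [hs0 x hx]
  calc |b x| * |u x| * Real.exp (-(s * (x - x₀)) / 2)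
      ≤ M * (A * Real.exp (s * (x - x₀))) * Real.exp (-(s * (x - x₀)) / 2) := by
        gcongr
        · exact hbM x hx
        · exact hd x hx
    _ = M * A * (Real.exp (s * (x - x₀)) * Real.exp (-(s * (x - x₀)) / 2)) := by ring
    _ ≤ M * A * 1 := by gcongr
    _ = _ := mul_one _

lemma weightMinus_eq {m ε : ℝ} (hm : 0 < m) (hε : 0 < ε) (x : ℝ) :
    weightMinus m ε x = Real.exp (-(-(√m / ε) * (x - -1)) / 2) := by
  have : 0 < √m := Real.sqrt_pos.2 hm
  rw [weightMinus, betaStar]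
  congr 1
  field_simp
  ring

lemma weightPlus_eq {m ε : ℝ} (hm : 0 < m) (hε : 0 < ε) (x : ℝ) :
    weightPlus m ε x = Real.exp (-(√m / ε * (x - 1)) / 2) := by
  have : 0 < √m := Real.sqrt_pos.2 hm
  rw [weightPlus, betaStar]
  congr 1
  field_simp
  ring

/-- The expansion for a fixed `ε`, for given bounds of the data and of the reduced solution. -/
lemma exists_expansion {k : ℕ} (hk : k = 1 ∨ k = 2) {ε m M C : ℝ} (hε : 0 < ε) (hm : 0 < m)
    {b b' b₁ f f' f₁ z₁ : ℝ → ℝ} (hb : H1Bound M b' b₁) (hf : H1Rep f' f₁) (hbb : b =ᵐ[volI] b')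
    (hff : f =ᵐ[volI] f') (hbm : ∀ x ∈ Icc (-1 : ℝ) 1, m ≤ b' x)
    (hz : H1Bound C (fun x => f' x / b' x) z₁) (hz₂ : k = 2 → ∃ z₂, H1Bound C z₁ z₂) :
    ∃ u uBLm uBLp uR : ℝ → ℝ,
      IsTheWeakSolution ε b f 0 0 u ∧
      IsTheWeakSolution ε b (fun _ => 0) (-(f' (-1) / b' (-1))) 0 uBLm ∧
      IsTheWeakSolution ε b (fun _ => 0) 0 (-(f' 1 / b' 1)) uBLp ∧
      (∀ᵐ x ∂volI, u x = f x / b x + uBLm x + uBLp x + uR x) ∧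
      MemH k uR ∧ energyNorm ε b uR ≤ (C + C / √m) * ε ^ k ∧
      MemH (k + 1) uBLm ∧ MemH (k + 1) uBLp ∧
      ε ^ 2 * weightedNorm (weightMinus m ε) (weakDeriv (weakDeriv uBLm)) ≤ 2 * (M * C) ∧
      ε ^ 2 * weightedNorm (weightPlus m ε) (weakDeriv (weakDeriv uBLp)) ≤ 2 * (M * C) := by
  have hbc := hb.rep.continuousOn
  have h0 : H1Rep (fun _ : ℝ => (0 : ℝ)) (fun _ => 0) :=
    .of_hasDerivAt (fun x => hasDerivAt_const x 0) continuous_const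
  have hC := hz.nonneg
  obtain ⟨u, p, w, h, hl, hr⟩ := exists_isClassicalSolution hε hm hbc hf.continuousOn hbm 0 0
  obtain ⟨um, pm, wm, hM, hml, hmr⟩ := exists_isClassicalSolution hε hm hbc h0.continuousOn hbm
    (-(f' (-1) / b' (-1))) 0
  obtain ⟨up, pp, wp, hP, hpl, hpr⟩ := exists_isClassicalSolution hε hm hbc h0.continuousOn hbm
    0 (-(f' 1 / b' 1))
  have hu3 := h.memH_three hε.ne' hb.rep hf
  have hm3 := hM.memH_three hε.ne' hb.rep h0
  have hp3 := hP.memH_three hε.ne' hb.rep h0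
  have hk2 : k ≤ 2 := by omega
  have hd := ((h.derivs.h1Rep.sub hz.rep).sub hM.derivs.h1Rep).sub hP.derivs.h1Rep
  have hd_l : u (-1) - f' (-1) / b' (-1) - um (-1) - up (-1) = 0 := by rw [hl, hml, hpl]; ring
  have hd_r : u 1 - f' 1 / b' 1 - um 1 - up 1 = 0 := by rw [hr, hmr, hpr]; ring
  have hE := energyForm_remainder hbc h hM hP hz.rep
    (fun x hx => mul_div_cancel₀ _ (hm.trans_le (hbm x hx)).ne') hd hd_l hd_r
  have hs : ε ^ 2 * (√m / ε) ^ 2 = m := by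
    rw [div_pow, Real.sq_sqrt hm.le]; field_simp
  have hsm : 0 < √m / ε := div_pos (Real.sqrt_pos.2 hm) hε
  have hzk : MemH k (fun x => f' x / b' x) := by
    rcases hk with rfl | rfl
    · exact hz.rep.memH (k := 0) hz.rep.memLp
    · obtain ⟨z₂, hz₂⟩ := hz₂ rfl
      exact hz.rep.memH (hz₂.rep.memH (k := 0) hz₂.rep.memLp)
  refine ⟨u, um, up, fun x => u x - f' x / b' x - um x - up x, ?_, ?_, ?_, ?_, ?_, ?_,
    memH_of_le (by omega) hm3, memH_of_le (by omega) hp3, ?_, ?_⟩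
  · have := h.isTheWeakSolution hm hbc hbm hbb hff
    rwa [hl, hr] at this
  · have := hM.isTheWeakSolution hm hbc hbm hbb (EventuallyEq.refl _ _)
    rwa [hml, hmr] at this
  · have := hP.isTheWeakSolution hm hbc hbm hbb (EventuallyEq.refl _ _)
    rwa [hpl, hpr] at this
  · filter_upwards [hbb, hff] with x e1 e2
    rw [e1, e2]; ring
  · exact (((memH_of_le (by omega) hu3).sub hzk).sub (memH_of_le (by omega) hm3)).sub
      (memH_of_le (by omega) hp3)
  · rw [energyNorm_eq hbb hbc hd (EventuallyEq.refl _ _)]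
    have hq : 0 ≤ C / √m := by positivity
    rcases hk with rfl | rfl
    · refine (sqrt_energyForm_le hε hm hC hbc hbm hd hE hz.rep.memLp hz.integral_sq_le).trans ?_
      rw [pow_one]
      gcongr
      linarith
    · obtain ⟨z₂, hz₂⟩ := hz₂ rfl
      refine (sqrt_energyForm_le_sq hm hC hbc hbm hd hd_l hd_r hE hz₂.rep
        hz₂.integral_sq_le).trans ?_
      gcongr
      linarith
  · refine boundaryLayer_bound hε hm hM hbm hb.abs_le hC (s := -(√m / ε)) (x₀ := -1)
      (by rw [neg_sq, hs]) (fun x hx => ?_) (weightMinus_eq hm hε) ?_ ?_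
    · have := hx.1
      nlinarith
    · rw [hml, abs_neg]
      simpa using hz.abs_le (-1) (by simp)
    · rw [hmr, abs_zero]
      positivity
  · refine boundaryLayer_bound hε hm hP hbm hb.abs_le hC (s := √m / ε) (x₀ := 1)
      hs (fun x hx => ?_) (weightPlus_eq hm hε) ?_ ?_
    · have := hx.2
      nlinarith
    · rw [hpl, abs_zero]
      positivity
    · rw [hpr, abs_neg]
      simpa using hz.abs_le 1 (by simp)

end SingPert

open SingPert in
theorem proposition2p1 (k : ℕ) (hk : k = 1 ∨ k = 2) (blo : ℝ) (hblo : 0 < blo) (Mb Mf : ℝ) :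
    ∃ C : ℝ, 0 < C ∧
      ∀ (b f : ℝ → ℝ) (bhi : ℝ), MemH k b → MemH k f →
        (∀ᵐ x ∂volI, blo ≤ b x ∧ b x ≤ bhi) → hNorm k b ≤ Mb → hNorm k f ≤ Mf →
        MemH k (fun x => f x / b x) ∧ hNorm k (fun x => f x / b x) ≤ C ∧
        ∃ l r : ℝ, HasTrace (fun x => f x / b x) (-1) l ∧ HasTrace (fun x => f x / b x) 1 r ∧
          ∀ ε : ℝ, 0 < ε → ε ≤ 1 →
            ∃ u uBLm uBLp uR : ℝ → ℝ,
              IsTheWeakSolution ε b f 0 0 u ∧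
              IsTheWeakSolution ε b (fun _ => 0) (-l) 0 uBLm ∧
              IsTheWeakSolution ε b (fun _ => 0) 0 (-r) uBLp ∧
              (∀ᵐ x ∂volI, u x = f x / b x + uBLm x + uBLp x + uR x) ∧
              MemH k uR ∧ energyNorm ε b uR ≤ C * ε ^ k ∧
              MemH (k + 1) uBLm ∧ MemH (k + 1) uBLp ∧
              ε ^ 2 * weightedNorm (weightMinus blo ε) (weakDeriv (weakDeriv uBLm)) ≤ C ∧
              ε ^ 2 * weightedNorm (weightPlus blo ε) (weakDeriv (weakDeriv uBLp)) ≤ C := by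
  -- The factor 2 is the loss in passing from `hNorm` to `H1Bound`.
  set M := 2 * (|Mb| + |Mf|) with hM
  obtain ⟨C, hC, hquot⟩ := exists_quotient_bound hblo M
  have hq : 0 ≤ C / √blo := by positivity
  have hMC : 0 ≤ M * C := by positivity
  have hb2 : 2 * Mb ≤ M := by linarith [le_abs_self Mb, abs_nonneg Mf]
  have hf2 : 2 * Mf ≤ M := by linarith [le_abs_self Mf, abs_nonneg Mb]
  -- `3 * C` covers the norm of `f / b`, `C + C / √blo` the remainder for both `k`, and `2 * (M *
  -- C)` the layers.
  refine ⟨3 * C + C / √blo + 2 * (M * C), by positivity,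
    fun b f bhi hbH hfH hae hbn hfn => ?_⟩
  obtain ⟨b', b₁, f', f₁, hbb, hff, hb, hf, hbf₂⟩ : ∃ b' b₁ f' f₁ : ℝ → ℝ, b =ᵐ[volI] b' ∧
      f =ᵐ[volI] f' ∧ H1Bound M b' b₁ ∧ H1Bound M f' f₁ ∧
      (k = 2 → ∃ b₂ f₂, H1Bound M b₁ b₂ ∧ H1Bound M f₁ f₂) := by
    rcases hk with rfl | rfl
    · obtain ⟨b', b₁, hbb, hb⟩ := exists_bound_of_memH_one hbH hbn
      obtain ⟨f', f₁, hff, hf⟩ := exists_bound_of_memH_one hfH hfn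
      exact ⟨b', b₁, f', f₁, hbb, hff, hb.mono hb2, hf.mono hf2, by omega⟩
    · obtain ⟨b', b₁, b₂, hbb, hb, hb'⟩ := exists_bound_of_memH_two hbH hbn
      obtain ⟨f', f₁, f₂, hff, hf, hf'⟩ := exists_bound_of_memH_two hfH hfn
      exact ⟨b', b₁, f', f₁, hbb, hff, hb.mono hb2, hf.mono hf2,
        fun _ => ⟨b₂, f₂, hb'.mono hb2, hf'.mono hf2⟩⟩
  have hbm : ∀ x ∈ Set.Icc (-1 : ℝ) 1, blo ≤ b' x := le_of_ae_le hb.rep.continuousOn <| by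
    filter_upwards [hae, hbb] with x h1 h2 using h2 ▸ h1.1
  obtain ⟨z₁, hz, hz₂⟩ := hquot b' b₁ f' f₁ hb hf hbm
  have hz₂' : k = 2 → ∃ z₂, H1Bound C z₁ z₂ := fun hk2 => by
    obtain ⟨b₂, f₂, hb₂, hf₂⟩ := hbf₂ hk2
    exact hz₂ b₂ f₂ hb₂ hf₂
  have hzz : (fun x => f x / b x) =ᵐ[volI] fun x => f' x / b' x := by
    filter_upwards [hbb, hff] with x e1 e2
    rw [e1, e2]
  have hmem : MemH k (fun x => f x / b x) ∧ hNorm k (fun x => f x / b x) ≤ 3 * C := by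
    rcases hk with rfl | rfl
    · exact ⟨(hz.rep.memH (k := 0) hz.rep.memLp).congr hzz.symm, hz.hNorm_one_le hzz⟩
    · obtain ⟨z₂, hz₂⟩ := hz₂' rfl
      exact ⟨(hz.rep.memH (hz₂.rep.memH (k := 0) hz₂.rep.memLp)).congr hzz.symm,
        hz.hNorm_two_le hz₂ hzz⟩
  refine ⟨hmem.1, hmem.2.trans (by linarith), _, _, hz.rep.hasTrace hzz (-1),
    hz.rep.hasTrace hzz 1, fun ε hε _ => ?_⟩
  obtain ⟨u, um, up, uR, h1, h2, h3, h4, h5, h6, h7, h8, h9, h10⟩ :=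
    exists_expansion hk hε hblo hb hf.rep hbb hff hbm hz hz₂'
  refine ⟨u, um, up, uR, h1, h2, h3, h4, h5, h6.trans ?_, h7, h8, h9.trans (by linarith),
    h10.trans (by linarith)⟩
  exact mul_le_mul_of_nonneg_right (by linarith) (by positivity)
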